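/- Let $n,m\ge 0$ and $h\ge 1$ be integers. All functions below are $C^\infty$. For a square matrix $S$ write $\langle S\rangle=S+S^\top$. A matrix function $M(s,t)$ is uniformly positive definite if it is symmetric and $M(s,t)\succeq\epsilon I$ for all $s,t$, with a constant $\epsilon>0$. For dynamics $\dot s=g(s,t)$, a symmetric matrix function $M(s,t)$ and $\gamma\in\mathbb R$ put $$\mathrm L[M,g,s,\gamma](s,t)=\sum_i g_i\frac{\partial M}{\partial s_i}+\frac{\partial M}{\partial t}+\Big\langle M\frac{\partial g}{\partial s}\Big\rangle+\gamma M .$$ The dynamics is contracting if there are a uniformly positive definite $M$ and $\gamma>0$ with $\mathrm L[M,g,s,\gamma](s,t)\preceq0$ for all $s,t$. Setting. Consider a plant $\dot x=f(x,u,t)$, $x\in\mathbb R^n$, $u\in\mathbb R^m$, and a discretization $x^0=x$, $x^{k+1}=f_{\mathrm d}(x^k,u^k,t^k)$, $0\le k<h$, where the times $t^k$ are functions of $t$ (typically $t^k=t+k\Delta t$). For $U=[u^0;\dots;u^{h-1}]\in\mathbb R^{hm}$ let $V(U,x,t)=\Phi(x^h,t^h)+\sum_{k=0}^{h-1}\ell(x^k,u^k,t^k)$,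 $\zeta=\nabla_UV$, $H=\partial\zeta/\partial U$, $\Pi_0U=u^0$. Assume $H(U,x,t)\succeq\lambda_H I$ for all $U,x,t$, with a constant $\lambda_H>0$, and let $U^*(x,t)$ be the minimizer of $V(\cdot,x,t)$. Assume also that $\|\partial f/\partial u\|$ is bounded on $\mathbb R^n\times\mathbb R^m\times\mathbb R$. Given $\eta:\mathbb R^{hm}\times\mathbb R\to\mathbb R^{hm}$ (the virtual dynamics $\dot z=\eta(z,t)$), the closed loop for $s=[x;U]$ is $\dot s=\phi(s,t)$, $$\phi(s,t)=\Big[f(x,\Pi_0U,t);\ H^{-1}\Big(\eta(\zeta,t)-\frac{\partial\zeta}{\partial x}f(x,\Pi_0U,t)-\frac{\partial\zeta}{\partial t}\Big)\Big],$$ and the optimally controlled dynamics is $\dot x^*=f(x^*,\Pi_0U^*(x^*,t),t)$. Put $f_{\mathrm r}(x,u_{\mathrm r},t)=f(x,\Pi_0U^*(x,t)+u_{\mathrm r},t)$ and $K(U,x,t)=-H^{-1}\frac{\partial\zeta}{\partial x}-\frac{\partial U^*}{\partial x}$. For matrix functions $P(x,t)\in\mathbb R^{n\times n}$ and $Q(z,t)\in\mathbb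 R^{hm\times hm}$ put $P_{xU}(x,u_{\mathrm r},t)=P(x,t)\frac{\partial f_{\mathrm r}}{\partial u_{\mathrm r}}(x,u_{\mathrm r},t)\Pi_0$ and, for $\kappa>0$, $$M(s,t)=\begin{bmatrix}P(x,t)&0\\0&0\end{bmatrix}+\kappa\Big(\frac{\partial\zeta}{\partial s}\Big)^{\!\top}Q(\zeta,t)\,\frac{\partial\zeta}{\partial s}.$$ Statement. Suppose $P,Q$ are uniformly positive definite, $P(x,t)\preceq p_{\max}I$ for all $x,t$ with some constant $p_{\max}$, and $\beta_x>\beta_{\mathrm p}>0$, $\beta_z>0$ are such that - $\mathrm L[Q,\eta,z,\beta_z](z,t)\preceq0$ for all $z,t$; - $\langle P_{xU}(x,u_{\mathrm r},t)K(U,x,t)\rangle\preceq\beta_{\mathrm p}P(x,t)$ for all $U,x,t$, where $u_{\mathrm r}=\Pi_0U-\Pi_0U^*(x,t)$; - $\mathrm L[P,f_{\mathrm r},x,\beta_x+\beta_{\mathrm p}](x,u_{\mathrm r},t)\preceq0$ for all $x,u_{\mathrm r},t$ (with $u_{\mathrm r}$ held fixed in the differentiation). Then: 1. There are $\kappa>0$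 and $\gamma>0$ such that $\mathrm L[M,\phi,s,\gamma](s,t)\preceq0$ for all $s,t$. 2. If moreover $\|\partial\zeta/\partial x\|$ is bounded on $\mathbb R^{hm}\times\mathbb R^n\times\mathbb R$, then the closed loop $\dot s=\phi(s,t)$ is contracting. 3. If $\eta(0,t)=0$ for all $t$, then for every $t_0$, every solution $s(t)=[x(t);U(t)]$ of the closed loop on $[t_0,\infty)$ and every solution $x^*(t)$ of the optimally controlled dynamics on $[t_0,\infty)$ one has $x(t)-x^*(t)\to0$ as $t\to\infty$. -/

import Mathlib

open scoped ContDiff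

noncomputable section

namespace Continuation

/-! ### Contraction of time-varying dynamics

Square matrices of size `n` are represented as linear operators of the Euclidean space `ℝⁿ`;
transposition is `ContinuousLinearMap.adjoint`, and `A ≤ B` is the Loewner order, i.e. `B - A`
is symmetric and positive semidefinite. -/

section Contraction

variable {E : Type*} [NormedAddCommGroup E] [InnerProductSpace ℝ E] [CompleteSpace E]

/-- `⟨S⟩ = S + Sᵀ`. -/
def symPart (S : E →L[ℝ] E) : E →L[ℝ] E := S + ContinuousLinearMap.adjoint S

/-- `L[M, g, s, γ](s, t) = 𝓛_g M + ∂M/∂t + ⟨M ∂g/∂s⟩ + γ M`; the Lie derivative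
`𝓛_g M = ∑ᵢ gᵢ ∂M/∂sᵢ` is the derivative of `M(·, t)` at `s` in the direction `g(s, t)`. -/
def contractionOp (M : E → ℝ → (E →L[ℝ] E)) (g : E → ℝ → E) (γ : ℝ) (s : E) (t : ℝ) :
    E →L[ℝ] E :=
  fderiv ℝ (fun y => M y t) s (g s t) + deriv (fun τ => M s τ) t
    + symPart (M s t ∘L fderiv ℝ (fun y => g y t) s) + γ • M s t

/-- `M(s, t)` is symmetric and `M(s, t) ⪰ ε I` for all `s, t`, for some `ε > 0`. -/
def UniformlyPosDef (M : E → ℝ → (E →L[ℝ] E)) : Prop :=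
  ∃ ε : ℝ, 0 < ε ∧ ∀ s t, ε • (1 : E →L[ℝ] E) ≤ M s t

/-- `M(s, t)` depends smoothly on `(s, t)`. -/
def SmoothMetric (M : E → ℝ → (E →L[ℝ] E)) : Prop :=
  ContDiff ℝ ∞ (fun p : E × ℝ => M p.1 p.2)

/-- The dynamics `ṡ = g(s, t)` is contracting with metric `M` and rate `γ`. -/
def ContractingWith (g : E → ℝ → E) (M : E → ℝ → (E →L[ℝ] E)) (γ : ℝ) : Prop :=
  SmoothMetric M ∧ UniformlyPosDef M ∧ 0 < γ ∧ ∀ s t, contractionOp M g γ s t ≤ 0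

/-- The dynamics `ṡ = g(s, t)` is contracting. -/
def Contracting (g : E → ℝ → E) : Prop :=
  ∃ (M : E → ℝ → (E →L[ℝ] E)) (γ : ℝ), ContractingWith g M γ

/-- `y` solves `ẏ(t) = g(y(t), t)` on `[t₀, ∞)`. -/
def IsTrajectory (g : E → ℝ → E) (t₀ : ℝ) (y : ℝ → E) : Prop :=
  ∀ t, t₀ ≤ t → HasDerivWithinAt y (g (y t) t) (Set.Ici t₀) t

end Contraction

/-! ### Model predictive control by the continuation method -/

/-- Vectors `[u⁰; …; u^{h-1}]` of `h` stacked inputs, with the Euclidean norm of `ℝ^{hm}`. -/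
abbrev InputSeq (m h : ℕ) : Type := PiLp 2 (fun _ : Fin h => EuclideanSpace ℝ (Fin m))

/-- The state space `ℝ^{n+hm}` of the closed loop: vectors `[x; U]` with the Euclidean norm. -/
abbrev LoopState (n m h : ℕ) : Type := WithLp 2 (EuclideanSpace ℝ (Fin n) × InputSeq m h)

/-- The data: the plant `f`, the discretized plant `fd`, the time grid `t ↦ t^k` (usually
`t + k Δt`), the stage cost `ℓ`, the terminal cost `Φ` and the virtual dynamics `η`, all smooth. -/
structure Problem (n m h : ℕ) where
  f : EuclideanSpace ℝ (Fin n) → EuclideanSpace ℝ (Fin m) → ℝ → EuclideanSpace ℝ (Fin n)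
  fd : EuclideanSpace ℝ (Fin n) → EuclideanSpace ℝ (Fin m) → ℝ → EuclideanSpace ℝ (Fin n)
  grid : ℕ → ℝ → ℝ
  ℓ : EuclideanSpace ℝ (Fin n) → EuclideanSpace ℝ (Fin m) → ℝ → ℝ
  Φ : EuclideanSpace ℝ (Fin n) → ℝ → ℝ
  η : InputSeq m h → ℝ → InputSeq m h
  smooth_f : ContDiff ℝ ∞
    (fun p : EuclideanSpace ℝ (Fin n) × EuclideanSpace ℝ (Fin m) × ℝ => f p.1 p.2.1 p.2.2)
  smooth_fd : ContDiff ℝ ∞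
    (fun p : EuclideanSpace ℝ (Fin n) × EuclideanSpace ℝ (Fin m) × ℝ => fd p.1 p.2.1 p.2.2)
  smooth_grid : ∀ k, ContDiff ℝ ∞ (grid k)
  smooth_ℓ : ContDiff ℝ ∞
    (fun p : EuclideanSpace ℝ (Fin n) × EuclideanSpace ℝ (Fin m) × ℝ => ℓ p.1 p.2.1 p.2.2)
  smooth_Φ : ContDiff ℝ ∞ (fun p : EuclideanSpace ℝ (Fin n) × ℝ => Φ p.1 p.2)
  smooth_η : ContDiff ℝ ∞ (fun p : InputSeq m h × ℝ => η p.1 p.2)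

namespace Problem

variable {n m h : ℕ} (S : Problem n m h)

/-- The predicted states `x^k(U, x, t)`, `k ≤ h`: `x⁰ = x`, `x^{k+1} = fd(x^k, u^k, t^k)`.
(For `k > h` the value is never used.) -/
def predict (U : InputSeq m h) (x : EuclideanSpace ℝ (Fin n)) (t : ℝ) :
    ℕ → EuclideanSpace ℝ (Fin n)
  | 0 => x
  | k + 1 =>
      if hk : k < h then S.fd (predict U x t k) (U ⟨k, hk⟩) (S.grid k t) else predict U x t k

/-- The objective `V(U, x, t)`. -/
def V (U : InputSeq m h) (x : EuclideanSpace ℝ (Fin n)) (t : ℝ) : ℝ :=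
  S.Φ (S.predict U x t h) (S.grid h t)
    + ∑ k : Fin h, S.ℓ (S.predict U x t k) (U k) (S.grid k t)

/-- The minimizer `U*(x, t)` of `V(·, x, t)`. -/
def Uopt (x : EuclideanSpace ℝ (Fin n)) (t : ℝ) : InputSeq m h :=
  Classical.epsilon fun U => ∀ U' : InputSeq m h, S.V U x t ≤ S.V U' x t

/-- `ζ(U, x, t) = ∇_U V(U, x, t)`. -/
def ζ (U : InputSeq m h) (x : EuclideanSpace ℝ (Fin n)) (t : ℝ) : InputSeq m h :=
  gradient (fun W => S.V W x t) U

/-- `H = ∂ζ/∂U`, the Hessian of `V` in `U`. -/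
def H (U : InputSeq m h) (x : EuclideanSpace ℝ (Fin n)) (t : ℝ) :
    InputSeq m h →L[ℝ] InputSeq m h :=
  fderiv ℝ (fun W => S.ζ W x t) U

/-- `∂ζ/∂x`. -/
def ζx (U : InputSeq m h) (x : EuclideanSpace ℝ (Fin n)) (t : ℝ) :
    EuclideanSpace ℝ (Fin n) →L[ℝ] InputSeq m h :=
  fderiv ℝ (fun y => S.ζ U y t) x

/-- `∂ζ/∂s` for `s = [x; U]`. -/
def ζs (s : LoopState n m h) (t : ℝ) : LoopState n m h →L[ℝ] InputSeq m h :=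
  fderiv ℝ (fun r : LoopState n m h => S.ζ r.snd r.fst t) s

/-- `K(U, x, t) = - H⁻¹ ∂ζ/∂x - ∂U*/∂x`. -/
def K (U : InputSeq m h) (x : EuclideanSpace ℝ (Fin n)) (t : ℝ) :
    EuclideanSpace ℝ (Fin n) →L[ℝ] InputSeq m h :=
  -((S.H U x t).inverse ∘L S.ζx U x t) - fderiv ℝ (fun y => S.Uopt y t) x

/-- The metric `M(s, t) = [P 0; 0 0] + κ (∂ζ/∂s)ᵀ Q(ζ(s, t), t) ∂ζ/∂s`. The first term is
`Eᵀ P E` with `E = [I 0]`. -/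
def metric (P : EuclideanSpace ℝ (Fin n) → ℝ →
      (EuclideanSpace ℝ (Fin n) →L[ℝ] EuclideanSpace ℝ (Fin n)))
    (Q : InputSeq m h → ℝ → (InputSeq m h →L[ℝ] InputSeq m h))
    (κ : ℝ) (s : LoopState n m h) (t : ℝ) : LoopState n m h →L[ℝ] LoopState n m h :=
  let E : LoopState n m h →L[ℝ] EuclideanSpace ℝ (Fin n) :=
    WithLp.fstL 2 ℝ (EuclideanSpace ℝ (Fin n)) (InputSeq m h)
  ContinuousLinearMap.adjoint E ∘L P s.fst t ∘L E
    + κ • (ContinuousLinearMap.adjoint (S.ζs s t) ∘L Q (S.ζ s.snd s.fst t) t ∘L S.ζs s t)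

variable [NeZero h]

/-- `Π₀ = [I 0 ⋯ 0]`, i.e. `Π₀ U = u⁰`. -/
def firstInput (m h : ℕ) [NeZero h] : InputSeq m h →L[ℝ] EuclideanSpace ℝ (Fin m) :=
  PiLp.proj 2 (fun _ : Fin h => EuclideanSpace ℝ (Fin m)) (0 : Fin h)

/-- `b(U, x, t) = η(ζ, t) - ∂ζ/∂x f(x, Π₀ U, t) - ∂ζ/∂t`. -/
def b (U : InputSeq m h) (x : EuclideanSpace ℝ (Fin n)) (t : ℝ) : InputSeq m h :=
  S.η (S.ζ U x t) t - S.ζx U x t (S.f x (firstInput m h U) t) - deriv (fun τ => S.ζ U x τ) t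

/-- The closed loop `φ(s, t) = [f(x, Π₀ U, t); H⁻¹ b]`, `s = [x; U]`. -/
def φ (s : LoopState n m h) (t : ℝ) : LoopState n m h :=
  WithLp.toLp 2 (S.f s.fst (firstInput m h s.snd) t,
    (S.H s.snd s.fst t).inverse (S.b s.snd s.fst t))

/-- The optimally controlled dynamics `x ↦ f(x, Π₀ U*(x, t), t)`. -/
def fopt (x : EuclideanSpace ℝ (Fin n)) (t : ℝ) : EuclideanSpace ℝ (Fin n) :=
  S.f x (firstInput m h (S.Uopt x t)) t

/-- `f_r(x, u_r, t) = f(x, Π₀ U*(x, t) + u_r, t)`. -/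
def fr (x : EuclideanSpace ℝ (Fin n)) (ur : EuclideanSpace ℝ (Fin m)) (t : ℝ) :
    EuclideanSpace ℝ (Fin n) :=
  S.f x (firstInput m h (S.Uopt x t) + ur) t

/-- The residual input `u_r = Π₀ U - Π₀ U*(x, t)`. -/
def residual (U : InputSeq m h) (x : EuclideanSpace ℝ (Fin n)) (t : ℝ) :
    EuclideanSpace ℝ (Fin m) :=
  firstInput m h U - firstInput m h (S.Uopt x t)

/-- `P_{xU}(x, u_r, t) = P(x, t) ∂f_r/∂u_r(x, u_r, t) Π₀`. -/
def PxU (P : EuclideanSpace ℝ (Fin n) → ℝ →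
      (EuclideanSpace ℝ (Fin n) →L[ℝ] EuclideanSpace ℝ (Fin n)))
    (x : EuclideanSpace ℝ (Fin n)) (ur : EuclideanSpace ℝ (Fin m)) (t : ℝ) :
    InputSeq m h →L[ℝ] EuclideanSpace ℝ (Fin n) :=
  P x t ∘L fderiv ℝ (fun v => S.fr x v t) ur ∘L firstInput m h

end Problem

end Continuation

end

open Continuation

/-!
The variational argument. For a variation `v` of the closed-loop state put `a = ∂ζ/∂s v`. Along the
closed loop `ζ` obeys `ż = η(z, t)`, so by the symmetry of the second derivative of `ζ` the vector
`a` obeys the variational equation of the virtual dynamics (`Loop.fderiv_ζs_apply`), and the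
contraction form of `(∂ζ/∂s)ᵀ Q ∂ζ/∂s` at `v` is the one of `Q` at `a`. The variation of the plant
is that of `f_r` with the residual input frozen plus the effect of `Π₀ (K δx + H⁻¹ a)` on the input
(`Loop.fderiv_φ_fst`). Hence the contraction form of the metric is the sum of the form of `P`, the
term `⟨P_{xU} K⟩`, the form of `κ Q` and one cross term `2 ⟨P δx, ∂f/∂u Π₀ H⁻¹ a⟩`
(`Loop.inner_contractionOp_metric`). As `P`, `∂f/∂u` and `H⁻¹` are bounded, Young's inequality
absorbs the cross term when `κ` is large. A bound for `∂ζ/∂x` makes `δU` controllable by `δx` and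
`a`, which makes the metric uniformly positive definite.

Convergence is obtained without flows or geodesics, which matters because `Q` has no upper bound and
global solutions of `ż = η(z, t)` are not given. Two points are joined by finite chains
(`FineChain`), whose length is measured by the metric at their vertices. A small Euler step maps
chains to chains and, for a contracting dynamics, shortens every sufficiently short link by a factor
`1 - (β/4) τ`, uniformly on compact sets (`exists_euler_link_le`); adding links for the Taylor
remainders and for a disturbance at the ends gives, after subdivision of a time interval, an
exponential estimate for the metric distance between a trajectory and a disturbed one
(`reach_of_contracting`). This is applied twice: to `ζ` and the equilibrium `0` of the virtual
dynamics, giving `ζ → 0`; then to `x` and `x*` with the dynamics `f_r(·, 0, ·)`, the disturbance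
being bounded by a multiple of the residual input, hence of `ζ` by strong convexity.

The minimizer is smooth since it is the unique zero of the strongly monotone field `ζ(·, x, t)` and
so agrees with an implicit function. The calculus is done for a closed loop in abstract inner product
spaces (`Loop`).
-/

open Continuation

/-! ### Loewner order and the contraction operator as quadratic forms -/

namespace Continuation

section QuadraticForms

open scoped InnerProductSpace

variable {E : Type*} [NormedAddCommGroup E] [InnerProductSpace ℝ E]

theorem inner_le_inner_of_le {A B : E →L[ℝ] E} (h : A ≤ B) (v : E) : ⟪A v, v⟫_ℝ ≤ ⟪B v, v⟫_ℝ := by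
  have := ((ContinuousLinearMap.le_def A B).1 h).2 v
  simp only [ContinuousLinearMap.reApplyInnerSelf_apply, _root_.sub_apply,
    inner_sub_left, RCLike.re_to_real] at this
  linarith

variable [CompleteSpace E]

theorem le_zero_of_inner_le_zero {A : E →L[ℝ] E} (hA : IsSelfAdjoint A)
    (h : ∀ v, ⟪A v, v⟫_ℝ ≤ 0) : A ≤ 0 := by
  rw [ContinuousLinearMap.le_def, zero_sub]
  refine ⟨hA.neg.isSymmetric, fun v => ?_⟩
  simp only [ContinuousLinearMap.reApplyInnerSelf_apply, _root_.neg_apply,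
    inner_neg_left, RCLike.re_to_real]
  linarith [h v]

theorem smul_one_le_iff {A : E →L[ℝ] E} {c : ℝ} :
    c • (1 : E →L[ℝ] E) ≤ A ↔ IsSelfAdjoint A ∧ ∀ v, c * ‖v‖ ^ 2 ≤ ⟪A v, v⟫_ℝ := by
  have hc : IsSelfAdjoint (c • (1 : E →L[ℝ] E)) := (IsSelfAdjoint.all c).smul (IsSelfAdjoint.one _)
  have hin : ∀ v : E, ⟪(c • (1 : E →L[ℝ] E)) v, v⟫_ℝ = c * ‖v‖ ^ 2 := fun v => by
    simp [inner_smul_left]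
  constructor
  · intro h
    refine ⟨?_, fun v => ?_⟩
    · have := ((ContinuousLinearMap.le_def _ _).1 h).isSelfAdjoint.add hc
      simpa using this
    · rw [← hin]
      exact inner_le_inner_of_le h v
  · rintro ⟨hA, h⟩
    rw [ContinuousLinearMap.le_def]
    refine ⟨(hA.sub hc).isSymmetric, fun v => ?_⟩
    rw [ContinuousLinearMap.reApplyInnerSelf_apply, _root_.sub_apply, inner_sub_left,
      hin, RCLike.re_to_real]
    linarith [h v]

theorem UniformlyPosDef.isSelfAdjoint {M : E → ℝ → (E →L[ℝ] E)} (hM : UniformlyPosDef M) (s : E)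
    (t : ℝ) : IsSelfAdjoint (M s t) := by
  obtain ⟨ε, -, h⟩ := hM
  exact (smul_one_le_iff.1 (h s t)).1

/-- The lower bound of a uniformly positive definite metric, written as a square. -/
theorem UniformlyPosDef.exists_sq_le {M : E → ℝ → (E →L[ℝ] E)} (hM : UniformlyPosDef M) :
    ∃ μ : ℝ, 0 < μ ∧ ∀ s t v, μ ^ 2 * ‖v‖ ^ 2 ≤ ⟪M s t v, v⟫_ℝ := by
  obtain ⟨ε, hε, h⟩ := hM
  refine ⟨√ε, Real.sqrt_pos.2 hε, fun s t v => ?_⟩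
  rw [Real.sq_sqrt hε.le]
  exact (smul_one_le_iff.1 (h s t)).2 v

/-- Young's inequality for a positive semidefinite form; the cross term of the closed-loop metric is
absorbed by it without an upper bound for `A v`. -/
theorem two_mul_inner_le {A : E →L[ℝ] E} (hA : IsSelfAdjoint A) (h : ∀ v, 0 ≤ ⟪A v, v⟫_ℝ)
    {a : ℝ} (ha : 0 < a) (v w : E) :
    2 * ⟪A v, w⟫_ℝ ≤ a * ⟪A v, v⟫_ℝ + a⁻¹ * ⟪A w, w⟫_ℝ := by
  have hsym : ⟪A w, v⟫_ℝ = ⟪A v, w⟫_ℝ := by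
    rw [real_inner_comm]; exact (hA.isSymmetric v w).symm
  have h1 := h (a • v - w)
  simp only [map_sub, map_smul, inner_sub_left, inner_sub_right, inner_smul_left,
    inner_smul_right, hsym, conj_trivial] at h1
  have h2 : 0 ≤ a⁻¹ * (a * (a * ⟪A v, v⟫_ℝ) - a * ⟪A v, w⟫_ℝ - (a * ⟪A v, w⟫_ℝ - ⟪A w, w⟫_ℝ)) :=
    mul_nonneg (inv_nonneg.2 ha.le) (by linarith)
  have h3 : a⁻¹ * (a * (a * ⟪A v, v⟫_ℝ) - a * ⟪A v, w⟫_ℝ - (a * ⟪A v, w⟫_ℝ - ⟪A w, w⟫_ℝ))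
      = a * ⟪A v, v⟫_ℝ - 2 * ⟪A v, w⟫_ℝ + a⁻¹ * ⟪A w, w⟫_ℝ := by
    field_simp
    ring
  linarith

theorem isSelfAdjoint_symPart (S : E →L[ℝ] E) : IsSelfAdjoint (symPart S) := by
  rw [IsSelfAdjoint, symPart, star_add, ContinuousLinearMap.star_eq_adjoint,
    ContinuousLinearMap.star_eq_adjoint, ContinuousLinearMap.adjoint_adjoint, add_comm]

theorem inner_symPart (S : E →L[ℝ] E) (v : E) : ⟪symPart S v, v⟫_ℝ = 2 * ⟪S v, v⟫_ℝ := by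
  rw [symPart, _root_.add_apply, inner_add_left,
    ContinuousLinearMap.adjoint_inner_left, real_inner_comm (S v) v]
  ring

/-- The two partial derivatives in `contractionOp` add up to the joint derivative in the direction
`(w, 1)`. -/
theorem fderiv_add_deriv {F G : Type*} [NormedAddCommGroup F] [NormedSpace ℝ F]
    [NormedAddCommGroup G] [NormedSpace ℝ G] {f : F → ℝ → G} {s : F} {t : ℝ}
    (hf : DifferentiableAt ℝ (fun p : F × ℝ => f p.1 p.2) (s, t)) (w : F) :
    fderiv ℝ (fun y => f y t) s w + deriv (fun τ => f s τ) t
      = fderiv ℝ (fun p : F × ℝ => f p.1 p.2) (s, t) (w, 1) := by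
  have h1 : HasFDerivAt (fun y => f y t)
      (fderiv ℝ (fun p : F × ℝ => f p.1 p.2) (s, t) ∘L
        ((ContinuousLinearMap.id ℝ F).prod 0)) s :=
    HasFDerivAt.comp (f := fun y : F => (y, t)) s hf.hasFDerivAt
      ((hasFDerivAt_id s).prodMk (hasFDerivAt_const t s))
  have h2 : HasDerivAt (fun τ => f s τ)
      (fderiv ℝ (fun p : F × ℝ => f p.1 p.2) (s, t) (0, 1)) t :=
    HasFDerivAt.comp_hasDerivAt (f := fun τ : ℝ => (s, τ)) t hf.hasFDerivAt
      ((hasDerivAt_const t s).prodMk (hasDerivAt_id t))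
  rw [h1.fderiv, h2.deriv, ContinuousLinearMap.comp_apply, ← map_add]
  simp

/-- Needed because `A ≤ 0` includes the symmetry of `A`. -/
theorem isSelfAdjoint_contractionOp {M : E → ℝ → (E →L[ℝ] E)} (hM : SmoothMetric M)
    (hsa : ∀ s t, IsSelfAdjoint (M s t)) (g : E → ℝ → E) (γ : ℝ) (s : E) (t : ℝ) :
    IsSelfAdjoint (contractionOp M g γ s t) := by
  have hd : DifferentiableAt ℝ (fun p : E × ℝ => M p.1 p.2) (s, t) :=
    hM.contDiffAt.differentiableAt (by simp)
  have hderiv : IsSelfAdjoint (fderiv ℝ (fun p : E × ℝ => M p.1 p.2) (s, t) (g s t, 1)) := by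
    rw [ContinuousLinearMap.isSelfAdjoint_iff_isSymmetric]
    intro v w
    set D := fderiv ℝ (fun p : E × ℝ => M p.1 p.2) (s, t)
    have h1 : HasFDerivAt (fun p : E × ℝ => ⟪M p.1 p.2 v, w⟫_ℝ)
        ((innerSL ℝ w) ∘L (ContinuousLinearMap.apply ℝ E v) ∘L D) (s, t) := by
      have := (((innerSL ℝ w) ∘L (ContinuousLinearMap.apply ℝ E v)).hasFDerivAt
        (x := M s t)).comp (s, t) hd.hasFDerivAt
      refine this.congr_of_eventuallyEq (Filter.Eventually.of_forall fun p => ?_)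
      simp [real_inner_comm]
    have h2 : HasFDerivAt (fun p : E × ℝ => ⟪M p.1 p.2 v, w⟫_ℝ)
        ((innerSL ℝ v) ∘L (ContinuousLinearMap.apply ℝ E w) ∘L D) (s, t) := by
      have := (((innerSL ℝ v) ∘L (ContinuousLinearMap.apply ℝ E w)).hasFDerivAt
        (x := M s t)).comp (s, t) hd.hasFDerivAt
      refine this.congr_of_eventuallyEq (Filter.Eventually.of_forall fun p => ?_)
      simpa using (hsa p.1 p.2).isSymmetric v w
    have h3 := congrArg (fun L => L (g s t, (1 : ℝ))) (h1.unique h2)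
    simpa [real_inner_comm] using h3
  rw [contractionOp, fderiv_add_deriv hd]
  exact (hderiv.add (isSelfAdjoint_symPart _)).add ((IsSelfAdjoint.all γ).smul (hsa s t))

/-- The quadratic form of `contractionOp`, in which the symmetrization becomes a factor `2`. -/
theorem inner_contractionOp {M : E → ℝ → (E →L[ℝ] E)} (hM : SmoothMetric M)
    (hsa : ∀ s t, IsSelfAdjoint (M s t)) (g : E → ℝ → E) (γ : ℝ) (s : E) (t : ℝ) (v : E) :
    ⟪contractionOp M g γ s t v, v⟫_ℝ
      = ⟪fderiv ℝ (fun p : E × ℝ => M p.1 p.2) (s, t) (g s t, 1) v, v⟫_ℝ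
        + 2 * ⟪M s t v, fderiv ℝ (fun y => g y t) s v⟫_ℝ + γ * ⟪M s t v, v⟫_ℝ := by
  have hd : DifferentiableAt ℝ (fun p : E × ℝ => M p.1 p.2) (s, t) :=
    hM.contDiffAt.differentiableAt (by simp)
  have h1 : ⟪M s t (fderiv ℝ (fun y => g y t) s v), v⟫_ℝ
      = ⟪M s t v, fderiv ℝ (fun y => g y t) s v⟫_ℝ := by
    rw [real_inner_comm]; exact ((hsa s t).isSymmetric v _).symm
  rw [contractionOp, fderiv_add_deriv hd]
  simp only [_root_.add_apply, inner_add_left, inner_symPart,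
    ContinuousLinearMap.comp_apply, _root_.smul_apply, inner_smul_left, h1,
    conj_trivial]

theorem hasDerivAt_line {A X : Type*} [NormedAddCommGroup A] [NormedSpace ℝ A]
    [NormedAddCommGroup X] [NormedSpace ℝ X] {l : A × ℝ → X} (s : A) (t : ℝ) (w : A)
    (hl : DifferentiableAt ℝ l (s, t)) :
    HasDerivAt (fun r : ℝ => l (s + r • w, t + r)) (fderiv ℝ l (s, t) (w, 1)) 0 := by
  have hline : HasDerivAt (fun r : ℝ => (s + r • w, t + r)) (w, (1 : ℝ)) 0 := by
    refine HasDerivAt.prodMk ?_ ?_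
    · simpa using ((hasDerivAt_id (0 : ℝ)).smul_const w).const_add s
    · simpa using (hasDerivAt_id (0 : ℝ)).const_add t
  exact HasFDerivAt.comp_hasDerivAt (l := l) (f := fun r : ℝ => (s + r • w, t + r)) 0
    (by simpa using hl.hasFDerivAt) hline

end QuadraticForms

section Chains

open scoped InnerProductSpace
open Set Filter Topology

/-! ### Chains and the length they measure -/

variable {E : Type*} [NormedAddCommGroup E] [InnerProductSpace ℝ E]

/-- `FineChain G δ a c L`: the points `a` and `c` are joined by a finite chain of points whose
consecutive members are at Euclidean distance at most `δ`, and whose length in the metric `G`,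
where a link `a → b` is measured at its initial point `a`, is at most `L`. -/
inductive FineChain (G : E → E →L[ℝ] E) (δ : ℝ) : E → E → ℝ → Prop
  | refl (a : E) : FineChain G δ a a 0
  | cons {a b c : E} {ℓ L : ℝ} (hδ : ‖b - a‖ ≤ δ) (hℓ : 0 ≤ ℓ) (hlen : ⟪G a (b - a), b - a⟫_ℝ ≤ ℓ ^ 2)
      (h : FineChain G δ b c L) : FineChain G δ a c (ℓ + L)

variable {G G' : E → E →L[ℝ] E} {δ : ℝ}

theorem FineChain.nonneg {a c : E} {L : ℝ} (h : FineChain G δ a c L) : 0 ≤ L := by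
  induction h with
  | refl => exact le_rfl
  | cons _ hℓ _ _ ih => exact add_nonneg hℓ ih

theorem FineChain.trans {a b c : E} {L L' : ℝ} (h : FineChain G δ a b L)
    (h' : FineChain G δ b c L') : FineChain G δ a c (L + L') := by
  induction h with
  | refl => simpa using h'
  | cons hδ hℓ hlen _ ih => rw [add_assoc]; exact .cons hδ hℓ hlen (ih h')

/-- A chain is at least as long, up to the constant of the metric, as the segment that joins its
ends. -/
theorem FineChain.mul_norm_le {μ : ℝ} (hμ : 0 < μ) (hG : ∀ y v, μ ^ 2 * ‖v‖ ^ 2 ≤ ⟪G y v, v⟫_ℝ)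
    {a c : E} {L : ℝ} (h : FineChain G δ a c L) : μ * ‖c - a‖ ≤ L := by
  induction h with
  | refl => simp
  | @cons a b c ℓ L hδ hℓ hlen _ ih =>
    have h1 : μ * ‖b - a‖ ≤ ℓ := by
      refine le_of_sq_le_sq ?_ hℓ
      rw [mul_pow]
      exact (hG a _).trans hlen
    have h2 : ‖c - a‖ ≤ ‖c - b‖ + ‖b - a‖ := by
      simpa using norm_add_le (c - b) (b - a)
    nlinarith

/-- Push-forward of a chain by a map that does not increase lengths by more than the factor `ρ`
near the chain. All points of a chain of length `L` are within `L / μ` of its end, so the estimates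
for the map are needed on a ball only. -/
theorem FineChain.map {μ : ℝ} (hμ : 0 < μ) (hG : ∀ y v, μ ^ 2 * ‖v‖ ^ 2 ≤ ⟪G y v, v⟫_ℝ)
    {Ψ : E → E} {ρ Λ R : ℝ} {c : E} (hρ : 0 ≤ ρ) (hΛ : 0 ≤ Λ)
    (hΨ : ∀ a ∈ Metric.closedBall c R, ∀ b ∈ Metric.closedBall c R, ‖b - a‖ ≤ δ →
      ⟪G' (Ψ a) (Ψ b - Ψ a), Ψ b - Ψ a⟫_ℝ ≤ ρ ^ 2 * ⟪G a (b - a), b - a⟫_ℝ)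
    (hlip : ∀ a ∈ Metric.closedBall c R, ∀ b ∈ Metric.closedBall c R,
      ‖Ψ b - Ψ a‖ ≤ Λ * ‖b - a‖)
    {a : E} {L : ℝ} (h : FineChain G δ a c L) (hL : L ≤ μ * R) :
    FineChain G' (Λ * δ) (Ψ a) (Ψ c) (ρ * L) := by
  have key : ∀ {a : E} {L : ℝ}, FineChain G δ a c L → L ≤ μ * R → a ∈ Metric.closedBall c R := by
    intro a L h hL
    rw [mem_closedBall_iff_norm']
    exact le_of_mul_le_mul_left ((h.mul_norm_le hμ hG).trans hL) hμ
  induction h with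
  | refl => simpa using FineChain.refl _
  | @cons a b c ℓ L hδ hℓ hlen h ih =>
    have hb : L ≤ μ * R := by linarith
    have hab : FineChain G δ a c (ℓ + L) := .cons hδ hℓ hlen h
    rw [mul_add]
    refine .cons ?_ (mul_nonneg hρ hℓ) ?_ (ih hΨ hlip hb key)
    · exact (hlip a (key hab hL) b (key h hb)).trans (mul_le_mul_of_nonneg_left hδ hΛ)
    · rw [mul_pow]
      exact (hΨ a (key hab hL) b (key h hb) hδ).trans
        (mul_le_mul_of_nonneg_left hlen (sq_nonneg ρ))

/-- `Reach G a c L`: the points `a` and `c` are joined by arbitrarily fine chains of `G`-length at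
most `L`. For a continuous metric the smallest such `L` is the Riemannian distance. -/
def Reach (G : E → E →L[ℝ] E) (a c : E) (L : ℝ) : Prop :=
  ∀ δ > 0, FineChain G δ a c L

theorem Reach.trans {a b c : E} {L L' : ℝ} (h : Reach G a b L) (h' : Reach G b c L') :
    Reach G a c (L + L') :=
  fun δ hδ => (h δ hδ).trans (h' δ hδ)

theorem Reach.nonneg {a c : E} {L : ℝ} (h : Reach G a c L) : 0 ≤ L := (h 1 one_pos).nonneg

theorem Reach.mono {a c : E} {L L' : ℝ} (h : Reach G a c L) (hL : L ≤ L') :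
    Reach G a c L' := by
  intro δ hδ
  have h1 : FineChain G δ a a ((L' - L) + 0) :=
    .cons (b := a) (by simpa using hδ.le) (sub_nonneg.2 hL) (by simpa using sq_nonneg _)
      (.refl a)
  have := h1.trans (h δ hδ)
  simpa using this

/-- A segment subdivided into `N` equal links. -/
theorem fineChain_segment {a v : E} {θ : ℝ} (hθ : 0 ≤ θ) {N : ℕ} (hN : 0 < N)
    (h : ∀ σ ∈ Icc (0 : ℝ) 1, ⟪G (a + σ • v) v, v⟫_ℝ ≤ θ ^ 2) (hδ : ‖v‖ / N ≤ δ) :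
    FineChain G δ a (a + v) θ := by
  have hN' : (0 : ℝ) < N := by exact_mod_cast hN
  have key : ∀ k : ℕ, k ≤ N → FineChain G δ (a + ((N - k : ℝ) / N) • v) (a + v) (k * (θ / N)) := by
    intro k
    induction k with
    | zero => intro _; simpa [hN'.ne'] using FineChain.refl (a + v)
    | succ k ih =>
      intro hk
      have hk' : (k : ℝ) + 1 ≤ N := by exact_mod_cast hk
      have hdiff : (a + ((N - k : ℝ) / N) • v) - (a + ((N - (k + 1 : ℕ) : ℝ) / N) • v)
          = (1 / N : ℝ) • v := by
        rw [add_sub_add_left_eq_sub, ← sub_smul]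
        congr 1
        push_cast
        field_simp
        ring
      have := FineChain.cons (G := G) (δ := δ) (ℓ := θ / N) (a := a + ((N - (k + 1 : ℕ) : ℝ) / N) • v)
        ?_ (by positivity) ?_ (ih (by omega))
      · convert this using 1
        push_cast
        ring
      · rw [hdiff, norm_smul, Real.norm_of_nonneg (by positivity)]
        calc (1 / N : ℝ) * ‖v‖ = ‖v‖ / N := by ring
          _ ≤ δ := hδ
      · rw [hdiff, map_smul, inner_smul_left, inner_smul_right, div_pow]
        have := h ((N - (k + 1 : ℕ) : ℝ) / N) ⟨by push_cast; apply div_nonneg <;> linarith, by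
          push_cast; rw [div_le_one hN']; linarith [(Nat.cast_nonneg k : (0 : ℝ) ≤ k)]⟩
        simp only [conj_trivial]
        calc (1 / N : ℝ) * (1 / N * ⟪G (a + ((N - (k + 1 : ℕ) : ℝ) / N) • v) v, v⟫_ℝ)
            ≤ (1 / N : ℝ) * (1 / N * θ ^ 2) := by gcongr
          _ = θ ^ 2 / N ^ 2 := by field_simp
  have := key N le_rfl
  rw [sub_self, zero_div, zero_smul, add_zero, mul_div_cancel₀ _ hN'.ne'] at this
  exact this

theorem reach_segment {a v : E} {θ : ℝ} (hθ : 0 ≤ θ)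
    (h : ∀ σ ∈ Icc (0 : ℝ) 1, ⟪G (a + σ • v) v, v⟫_ℝ ≤ θ ^ 2) : Reach G a (a + v) θ := by
  intro δ hδ
  obtain ⟨N, hN⟩ := exists_nat_gt (‖v‖ / δ)
  have hN' : (0 : ℝ) < N := (div_nonneg (norm_nonneg v) hδ.le).trans_lt hN
  refine fineChain_segment hθ (N := N) (by exact_mod_cast hN') h ?_
  rw [div_lt_iff₀ hδ] at hN
  rw [div_le_iff₀ hN']
  linarith

/-! ### Euler steps shrink short links -/

theorem fderiv_partial_left {F F' : Type*} [NormedAddCommGroup F] [NormedSpace ℝ F]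
    [NormedAddCommGroup F'] [NormedSpace ℝ F'] {X : Type*} [NormedAddCommGroup X] [NormedSpace ℝ X]
    {f : F → X → F'} {s : F} {t : X}
    (hf : DifferentiableAt ℝ (fun p : F × X => f p.1 p.2) (s, t)) :
    HasFDerivAt (fun y => f y t)
      (fderiv ℝ (fun p : F × X => f p.1 p.2) (s, t) ∘L ContinuousLinearMap.inl ℝ F X) s :=
  HasFDerivAt.comp (f := fun y : F => (y, t)) s hf.hasFDerivAt
    ((hasFDerivAt_id s).prodMk (hasFDerivAt_const t s))

/-- The mean `∫₀¹ ∂g/∂y (y + σ w, t) dσ`, which turns the increment `g(y + w, t) - g(y, t)` into a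
linear expression in `w`. -/
noncomputable def meanFDeriv (g : E → ℝ → E) (y w : E) (t : ℝ) : E →L[ℝ] E :=
  ∫ σ in (0 : ℝ)..1,
    fderiv ℝ (fun p : E × ℝ => g p.1 p.2) (y + σ • w, t) ∘L ContinuousLinearMap.inl ℝ E ℝ

theorem continuous_partial_fderiv {g : E → ℝ → E} (hg : ContDiff ℝ ∞ (fun p : E × ℝ => g p.1 p.2)) :
    Continuous fun p : E × ℝ =>
      fderiv ℝ (fun p : E × ℝ => g p.1 p.2) p ∘L ContinuousLinearMap.inl ℝ E ℝ :=
  (hg.continuous_fderiv (by simp)).clm_comp continuous_const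

theorem continuous_meanFDeriv {g : E → ℝ → E} (hg : ContDiff ℝ ∞ (fun p : E × ℝ => g p.1 p.2)) :
    Continuous fun p : E × E × ℝ => meanFDeriv g p.1 p.2.1 p.2.2 := by
  apply intervalIntegral.continuous_parametric_intervalIntegral_of_continuous'
  exact (continuous_partial_fderiv hg).comp
    (f := fun q : (E × E × ℝ) × ℝ => (q.1.1 + q.2 • q.1.2.1, q.1.2.2)) (by fun_prop)

variable [FiniteDimensional ℝ E]

theorem meanFDeriv_apply {g : E → ℝ → E} (hg : ContDiff ℝ ∞ (fun p : E × ℝ => g p.1 p.2))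
    (y w : E) (t : ℝ) : meanFDeriv g y w t w = g (y + w) t - g y t := by
  have hc : Continuous fun σ : ℝ =>
      fderiv ℝ (fun p : E × ℝ => g p.1 p.2) (y + σ • w, t) ∘L ContinuousLinearMap.inl ℝ E ℝ :=
    (continuous_partial_fderiv hg).comp (f := fun σ : ℝ => (y + σ • w, t)) (by fun_prop)
  rw [meanFDeriv, ContinuousLinearMap.intervalIntegral_apply (hc.intervalIntegrable _ _)]
  have hd : ∀ σ ∈ uIcc (0 : ℝ) 1, HasDerivAt (fun σ : ℝ => g (y + σ • w) t)
      ((fderiv ℝ (fun p : E × ℝ => g p.1 p.2) (y + σ • w, t) ∘L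
        ContinuousLinearMap.inl ℝ E ℝ) w) σ := by
    intro σ _
    have h1 : HasDerivAt (fun σ : ℝ => y + σ • w) w σ := by
      simpa using ((hasDerivAt_id σ).smul_const w).const_add y
    exact (fderiv_partial_left (hg.contDiffAt.differentiableAt (by simp))).comp_hasDerivAt σ h1
  rw [intervalIntegral.integral_eq_sub_of_hasDerivAt hd
    ((hc.clm_apply continuous_const).intervalIntegrable _ _)]
  simp

theorem meanFDeriv_zero {g : E → ℝ → E} (hg : ContDiff ℝ ∞ (fun p : E × ℝ => g p.1 p.2))
    (y : E) (t : ℝ) : meanFDeriv g y 0 t = fderiv ℝ (fun y => g y t) y := by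
  rw [(fderiv_partial_left (hg.contDiffAt.differentiableAt (by simp))).fderiv, meanFDeriv]
  simp

/-- The derivative in `τ` of the pull-back of the metric `M(·, t + τ)` by the Euler map
`y ↦ y + τ g(y, t)`, in the averaged form that is exact for the link `y → y + w`. -/
noncomputable def eulerRate (M : E → ℝ → (E →L[ℝ] E)) (g : E → ℝ → E) (τ : ℝ) (y w : E) (t : ℝ) : E →L[ℝ] E :=
  let A : E →L[ℝ] E := 1 + τ • meanFDeriv g y w t
  ContinuousLinearMap.adjoint A ∘L
      fderiv ℝ (fun p : E × ℝ => M p.1 p.2) (y + τ • g y t, t + τ) (g y t, 1) ∘L A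
    + ContinuousLinearMap.adjoint (meanFDeriv g y w t) ∘L M (y + τ • g y t) (t + τ) ∘L A
    + ContinuousLinearMap.adjoint A ∘L M (y + τ • g y t) (t + τ) ∘L meanFDeriv g y w t

theorem continuous_eulerRate {M : E → ℝ → (E →L[ℝ] E)} {g : E → ℝ → E} (hM : SmoothMetric M)
    (hg : ContDiff ℝ ∞ (fun p : E × ℝ => g p.1 p.2)) :
    Continuous fun p : ℝ × E × E × ℝ => eulerRate M g p.1 p.2.1 p.2.2.1 p.2.2.2 := by
  have hmean : Continuous fun p : ℝ × E × E × ℝ => meanFDeriv g p.2.1 p.2.2.1 p.2.2.2 :=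
    (continuous_meanFDeriv hg).comp continuous_snd
  have hgc : Continuous fun p : ℝ × E × E × ℝ => g p.2.1 p.2.2.2 :=
    hg.continuous.comp (f := fun p : ℝ × E × E × ℝ => (p.2.1, p.2.2.2)) (by fun_prop)
  have hpt : Continuous fun p : ℝ × E × E × ℝ =>
      (p.2.1 + p.1 • g p.2.1 p.2.2.2, p.2.2.2 + p.1) := by fun_prop
  have hMc : Continuous fun p : ℝ × E × E × ℝ =>
      M (p.2.1 + p.1 • g p.2.1 p.2.2.2) (p.2.2.2 + p.1) := hM.continuous.comp hpt
  have hdM : Continuous fun p : ℝ × E × E × ℝ => fderiv ℝ (fun p : E × ℝ => M p.1 p.2)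
      (p.2.1 + p.1 • g p.2.1 p.2.2.2, p.2.2.2 + p.1) (g p.2.1 p.2.2.2, (1 : ℝ)) :=
    ((hM.continuous_fderiv (by simp)).comp hpt).clm_apply (hgc.prodMk continuous_const)
  have hA : Continuous fun p : ℝ × E × E × ℝ =>
      (1 : E →L[ℝ] E) + p.1 • meanFDeriv g p.2.1 p.2.2.1 p.2.2.2 := by fun_prop
  have hadj : Continuous (ContinuousLinearMap.adjoint : (E →L[ℝ] E) → (E →L[ℝ] E)) :=
    (ContinuousLinearMap.adjoint (𝕜 := ℝ) (E := E) (F := E)).continuous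
  unfold eulerRate
  exact (((hadj.comp hA).clm_comp (hdM.clm_comp hA)).add
    ((hadj.comp hmean).clm_comp (hMc.clm_comp hA))).add
    ((hadj.comp hA).clm_comp (hMc.clm_comp hmean))

/-- `eulerRate` is the derivative of the squared length of the Euler image of the link `y → y + w`:
by `meanFDeriv_apply` that image is `w + r • meanFDeriv g y w t w`. -/
theorem hasDerivAt_eulerLink {M : E → ℝ → (E →L[ℝ] E)} {g : E → ℝ → E} (hM : SmoothMetric M)
    (y w : E) (t τ : ℝ) :
    HasDerivAt (fun r : ℝ => ⟪M (y + r • g y t) (t + r) (w + r • meanFDeriv g y w t w),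
      w + r • meanFDeriv g y w t w⟫_ℝ) ⟪eulerRate M g τ y w t w, w⟫_ℝ τ := by
  have hu : HasDerivAt (fun r : ℝ => w + r • meanFDeriv g y w t w) (meanFDeriv g y w t w) τ := by
    simpa using ((hasDerivAt_id τ).smul_const (meanFDeriv g y w t w)).const_add w
  have hp : HasDerivAt (fun r : ℝ => (y + r • g y t, t + r)) (g y t, (1 : ℝ)) τ := by
    refine HasDerivAt.prodMk ?_ ?_
    · simpa using ((hasDerivAt_id τ).smul_const (g y t)).const_add y
    · simpa using (hasDerivAt_id τ).const_add t
  have hMd : HasDerivAt (fun r : ℝ => M (y + r • g y t) (t + r))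
      (fderiv ℝ (fun p : E × ℝ => M p.1 p.2) (y + τ • g y t, t + τ) (g y t, 1)) τ :=
    HasFDerivAt.comp_hasDerivAt (f := fun r : ℝ => (y + r • g y t, t + r)) τ
      (hM.contDiffAt.differentiableAt (by simp)).hasFDerivAt hp
  refine ((hMd.clm_apply hu).inner ℝ hu).congr_deriv ?_
  simp only [eulerRate, _root_.add_apply, ContinuousLinearMap.comp_apply, inner_add_left,
    ContinuousLinearMap.adjoint_inner_left, one_apply_eq_self, _root_.smul_apply]
  ring

/-- For a contracting dynamics, a small Euler step shrinks the length of every short link by the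
factor `1 - (β/4) τ`, uniformly on compact sets. -/
theorem exists_euler_link_le {M : E → ℝ → (E →L[ℝ] E)} {g : E → ℝ → E} {β μ : ℝ}
    (hM : SmoothMetric M) (hsa : ∀ s t, IsSelfAdjoint (M s t))
    (hg : ContDiff ℝ ∞ (fun p : E × ℝ => g p.1 p.2)) (hμ : 0 < μ)
    (hpos : ∀ s t v, μ ^ 2 * ‖v‖ ^ 2 ≤ ⟪M s t v, v⟫_ℝ) (hβ : 0 < β)
    (hcontr : ∀ s t, contractionOp M g β s t ≤ 0) (R T₁ T₂ : ℝ) :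
    ∃ δ > 0, ∀ τ ∈ Icc 0 δ, ∀ t ∈ Icc T₁ T₂, ∀ a ∈ Metric.closedBall (0 : E) R, ∀ b,
      ‖b - a‖ ≤ δ →
      ⟪M (a + τ • g a t) (t + τ) ((b + τ • g b t) - (a + τ • g a t)),
        (b + τ • g b t) - (a + τ • g a t)⟫_ℝ
        ≤ (1 - β / 4 * τ) ^ 2 * ⟪M a t (b - a), b - a⟫_ℝ := by
  have hcpt : IsCompact (Icc (0 : ℝ) 1 ×ˢ Metric.closedBall (0 : E) R ×ˢ
      Metric.closedBall (0 : E) 1 ×ˢ Icc T₁ T₂) :=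
    isCompact_Icc.prod ((isCompact_closedBall _ _).prod
      ((isCompact_closedBall _ _).prod isCompact_Icc))
  have huc := Metric.uniformContinuousOn_iff_le.1 (hcpt.uniformContinuousOn_of_continuous
    (continuous_eulerRate hM hg).continuousOn) (β / 2 * μ ^ 2) (by positivity)
  obtain ⟨δ, hδ, huc⟩ := huc
  -- the tolerance `(β/2) μ²` costs at most `(β/2) ⟨M w, w⟩`, which leaves the rate `β/2` for squares
  refine ⟨min δ 1, by positivity, fun τ hτ t ht a ha b hab => ?_⟩
  have hδ1 := min_le_left δ 1
  have hδ2 := min_le_right δ 1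
  set w := b - a with hw
  have hb : b = a + w := by rw [hw]; abel
  have hrate : ∀ r ∈ Icc 0 τ,
      ⟪eulerRate M g r a w t w, w⟫_ℝ ≤ -(β / 2) * ⟪M a t w, w⟫_ℝ := by
    intro r hr
    have hr1 : r ≤ min δ 1 := hr.2.trans hτ.2
    have h1 := huc (r, a, w, t) ⟨⟨hr.1, hr1.trans hδ2⟩, ha, by simpa using hab.trans hδ2, ht⟩
      (0, a, 0, t) ⟨⟨le_rfl, zero_le_one⟩, ha, by simp, ht⟩ (by
        simp only [Prod.dist_eq, dist_self, dist_zero_right, Real.norm_of_nonneg hr.1]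
        refine max_le (hr1.trans hδ1) (max_le hδ.le (max_le (hab.trans hδ1) hδ.le)))
    rw [dist_eq_norm] at h1
    have h2 : ⟪(eulerRate M g r a w t - eulerRate M g 0 a 0 t) w, w⟫_ℝ
        ≤ β / 2 * μ ^ 2 * ‖w‖ ^ 2 := by
      refine (real_inner_le_norm _ _).trans ?_
      calc ‖(eulerRate M g r a w t - eulerRate M g 0 a 0 t) w‖ * ‖w‖
          ≤ (β / 2 * μ ^ 2 * ‖w‖) * ‖w‖ := mul_le_mul_of_nonneg_right
            (ContinuousLinearMap.le_of_opNorm_le _ h1 w) (norm_nonneg w)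
        _ = β / 2 * μ ^ 2 * ‖w‖ ^ 2 := by ring
    rw [_root_.sub_apply, inner_sub_left] at h2
    -- at `τ = 0`, `w = 0` the rate is the contraction form without the term `β M`
    have h3 : ⟪eulerRate M g 0 a 0 t w, w⟫_ℝ ≤ -β * ⟪M a t w, w⟫_ℝ := by
      have h4 := inner_le_inner_of_le (hcontr a t) w
      rw [inner_contractionOp hM hsa] at h4
      have h5 : ⟪M a t (fderiv ℝ (fun y => g y t) a w), w⟫_ℝ
          = ⟪M a t w, fderiv ℝ (fun y => g y t) a w⟫_ℝ := by
        rw [real_inner_comm]; exact ((hsa a t).isSymmetric w _).symm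
      simp only [eulerRate, meanFDeriv_zero hg, zero_smul, add_zero, _root_.add_apply,
        ContinuousLinearMap.comp_apply, inner_add_left, ContinuousLinearMap.adjoint_inner_left,
        one_apply_eq_self, h5]
      simp only [_root_.zero_apply, inner_zero_left] at h4
      linarith
    have h6 := hpos a t w
    nlinarith
  have hmvt := (convex_Icc (0 : ℝ) τ).image_sub_le_mul_sub_of_deriv_le
    (f := fun r : ℝ => ⟪M (a + r • g a t) (t + r) (w + r • meanFDeriv g a w t w),
      w + r • meanFDeriv g a w t w⟫_ℝ)
    (fun r _ => (hasDerivAt_eulerLink hM a w t r).continuousAt.continuousWithinAt)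
    (fun r _ => (hasDerivAt_eulerLink hM a w t r).differentiableAt.differentiableWithinAt)
    (fun r hr => by
      rw [(hasDerivAt_eulerLink hM a w t r).deriv]
      exact hrate r (interior_subset hr)) 0 ⟨le_rfl, hτ.1⟩ τ ⟨hτ.1, le_rfl⟩ hτ.1
  have hlink : (b + τ • g b t) - (a + τ • g a t) = w + τ • meanFDeriv g a w t w := by
    rw [meanFDeriv_apply hg, ← hb, hw, smul_sub]
    abel
  rw [hlink]
  simp only [zero_smul, add_zero, sub_zero] at hmvt
  have h7 : 0 ≤ ⟪M a t w, w⟫_ℝ := le_trans (by positivity) (hpos a t w)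
  have h8 := mul_nonneg (sq_nonneg (β / 4 * τ)) h7
  linarith
end Chains

section Convergence

open scoped InnerProductSpace
open Set Filter Topology

/-! ### Convergence of trajectories of a perturbed contracting dynamics -/

/-- A `C¹` curve on a compact interval has first-order expansions with uniform remainder. -/
theorem exists_uniform_taylor {E : Type*} [NormedAddCommGroup E] [NormedSpace ℝ E]
    {y y' : ℝ → E} {T₁ T₂ : ℝ}
    (hy : ∀ t ∈ Icc T₁ T₂, HasDerivWithinAt y (y' t) (Icc T₁ T₂) t)
    (hc : ContinuousOn y' (Icc T₁ T₂)) {ε : ℝ} (hε : 0 < ε) :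
    ∃ δ > 0, ∀ τ ∈ Icc 0 δ, ∀ t ∈ Icc T₁ T₂, t + τ ∈ Icc T₁ T₂ →
      ‖y (t + τ) - (y t + τ • y' t)‖ ≤ ε * τ := by
  obtain ⟨δ, hδ, huc⟩ := Metric.uniformContinuousOn_iff_le.1
    (isCompact_Icc.uniformContinuousOn_of_continuous hc) ε hε
  refine ⟨δ, hδ, fun τ hτ t ht htτ => ?_⟩
  have hsub : Icc t (t + τ) ⊆ Icc T₁ T₂ := Icc_subset_Icc ht.1 htτ.2
  have h := (convex_Icc t (t + τ)).norm_image_sub_le_of_norm_hasDerivWithin_le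
    (f := fun r => y r - r • y' t) (f' := fun r => y' r - y' t) (C := ε)
    (x := t) (y := t + τ)
    (fun r hr => by
      simpa using ((hy r (hsub hr)).mono hsub).fun_sub
        ((hasDerivWithinAt_id r _).smul_const (y' t)))
    (fun r hr => by
      rw [← dist_eq_norm]
      refine huc r (hsub hr) t ht ?_
      rw [Real.dist_eq, abs_le]
      constructor <;> linarith [hr.1, hr.2, hτ.1, hτ.2])
    ⟨le_rfl, by linarith [hτ.1]⟩ ⟨by linarith [hτ.1], le_rfl⟩
  rw [add_sub_cancel_left, Real.norm_of_nonneg hτ.1] at h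
  convert h using 2
  module

variable {E : Type*} [NormedAddCommGroup E] [InnerProductSpace ℝ E]

theorem exists_reach {G : E → E →L[ℝ] E} (hG : Continuous G) (a c : E) : ∃ L, Reach G a c L := by
  have hcont : Continuous fun σ : ℝ => ⟪G (a + σ • (c - a)) (c - a), c - a⟫_ℝ := by fun_prop
  obtain ⟨C, hC⟩ := (isCompact_Icc (a := (0 : ℝ)) (b := 1)).exists_bound_of_continuousOn
    hcont.continuousOn
  have hC0 : 0 ≤ C := (norm_nonneg _).trans (hC 0 (by simp))
  refine ⟨C + 1, ?_⟩
  have := reach_segment (G := G) (a := a) (v := c - a) (θ := C + 1) (by linarith) fun σ hσ =>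
    (Real.le_norm_self _).trans ((hC σ hσ).trans (by nlinarith))
  simpa using this

variable [FiniteDimensional ℝ E] {M : E → ℝ → (E →L[ℝ] E)} {g : E → ℝ → E} {β μ : ℝ}

/-- One small time step: if `y₁(t)` and `y₂(t)` are joined by fine chains of length `L`, the Euler
image of these chains, completed by the links `y₁(t + τ) → y₁(t) + τ g` and
`y₂(t) + τ g → y₂(t + τ)`, joins `y₁(t + τ)` and `y₂(t + τ)`. The disturbance of `y₁` is measured by
`M` at arbitrary points, and only the remainders of the Taylor expansions, which are `o(τ)`, are
measured by means of a bound for `M` on a compact set. -/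
theorem exists_reach_step
    (hM : SmoothMetric M) (hsa : ∀ s t, IsSelfAdjoint (M s t))
    (hg : ContDiff ℝ ∞ (fun p : E × ℝ => g p.1 p.2)) (hμ : 0 < μ)
    (hpos : ∀ s t v, μ ^ 2 * ‖v‖ ^ 2 ≤ ⟪M s t v, v⟫_ℝ) (hβ : 0 < β)
    (hcontr : ∀ s t, contractionOp M g β s t ≤ 0) {y₁ y₁' y₂ : ℝ → E} {T₁ T₂ : ℝ}
    (hy₁ : ∀ t ∈ Icc T₁ T₂, HasDerivWithinAt y₁ (y₁' t) (Icc T₁ T₂) t)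
    (hy₁' : ContinuousOn y₁' (Icc T₁ T₂))
    (hy₂ : ∀ t ∈ Icc T₁ T₂, HasDerivWithinAt y₂ (g (y₂ t) t) (Icc T₁ T₂) t)
    {θ : ℝ} (hθ : 0 ≤ θ) (hdist : ∀ t ∈ Icc T₁ T₂, ∀ y t',
      ⟪M y t' (y₁' t - g (y₁ t) t), y₁' t - g (y₁ t) t⟫_ℝ ≤ θ ^ 2)
    (Lmax : ℝ) {ε : ℝ} (hε : 0 < ε) :
    ∃ δ > 0, ∀ τ ∈ Icc 0 δ, ∀ t ∈ Icc T₁ T₂, t + τ ∈ Icc T₁ T₂ → ∀ L ≤ Lmax,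
      Reach (fun y => M y t) (y₁ t) (y₂ t) L →
      Reach (fun y => M y (t + τ)) (y₁ (t + τ)) (y₂ (t + τ))
        ((1 - β / 4 * τ) * L + τ * (θ + ε)) := by
  have hy₁c : ContinuousOn y₁ (Icc T₁ T₂) := fun t ht => (hy₁ t ht).continuousWithinAt
  have hy₂c : ContinuousOn y₂ (Icc T₁ T₂) := fun t ht => (hy₂ t ht).continuousWithinAt
  have hgy₂ : ContinuousOn (fun t => g (y₂ t) t) (Icc T₁ T₂) :=
    hg.continuous.comp_continuousOn (hy₂c.prodMk continuousOn_id)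
  obtain ⟨B₁, hB₁⟩ := isCompact_Icc.exists_bound_of_continuousOn hy₁c
  obtain ⟨B₂, hB₂⟩ := isCompact_Icc.exists_bound_of_continuousOn hy₂c
  set R := B₂ + Lmax / μ with hR
  obtain ⟨δ, hδ, hlink⟩ := exists_euler_link_le hM hsa hg hμ hpos hβ hcontr R T₁ T₂
  -- a Lipschitz constant of `g(·, t)` on the ball that contains the chains
  obtain ⟨C, hC⟩ := ((isCompact_closedBall (0 : E) R).prod
    ((isCompact_closedBall (0 : E) (2 * R)).prod (isCompact_Icc (a := T₁) (b := T₂)))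
    ).exists_bound_of_continuousOn (continuous_meanFDeriv hg).continuousOn
  -- a bound for the metric near the two trajectories
  obtain ⟨m, hm⟩ := ((isCompact_closedBall (0 : E) (max B₁ B₂ + 1)).prod
    (isCompact_Icc (a := T₁) (b := T₂))).exists_bound_of_continuousOn hM.continuous.continuousOn
  -- `m' ≥ 1` is chosen so that `m ≤ m' ^ 2`
  set m' := |m| + 1 with hm'
  have hm'1 : 1 ≤ m' := by rw [hm']; linarith [abs_nonneg m]
  have hrest : ∀ t ∈ Icc T₁ T₂, ∀ y ∈ Metric.closedBall (0 : E) (max B₁ B₂ + 1), ∀ v,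
      ⟪M y t v, v⟫_ℝ ≤ (m' * ‖v‖) ^ 2 := by
    intro t ht y hy v
    have h1 : ‖M y t‖ ≤ m := hm (y, t) ⟨hy, ht⟩
    have h2 : m ≤ m' ^ 2 := by nlinarith [le_abs_self m]
    calc ⟪M y t v, v⟫_ℝ ≤ ‖M y t v‖ * ‖v‖ := real_inner_le_norm _ _
      _ ≤ (m' ^ 2 * ‖v‖) * ‖v‖ := by
          gcongr
          exact ContinuousLinearMap.le_of_opNorm_le _ (h1.trans h2) v
      _ = (m' * ‖v‖) ^ 2 := by ring
  set ε' := min (ε / (2 * m')) 1 with hε'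
  have hε'0 : 0 < ε' := by positivity
  have hε'1 : m' * ε' ≤ ε / 2 := by
    calc m' * ε' ≤ m' * (ε / (2 * m')) := by gcongr; exact min_le_left _ _
      _ = ε / 2 := by field_simp
  obtain ⟨δ₁, hδ₁, ht₁⟩ := exists_uniform_taylor hy₁ hy₁' hε'0
  obtain ⟨δ₂, hδ₂, ht₂⟩ := exists_uniform_taylor hy₂ hgy₂ hε'0
  refine ⟨min (min δ (4 / β)) (min 1 (min δ₁ δ₂)), by positivity,
    fun τ hτ t ht htτ L hL hreach => ?_⟩
  obtain ⟨hτ0, hτle⟩ := hτ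
  simp only [le_min_iff] at hτle
  obtain ⟨⟨hτδ, hτβ⟩, hτ1, hτδ₁, hτδ₂⟩ := hτle
  have hρ : 0 ≤ 1 - β / 4 * τ := by
    have : β / 4 * τ ≤ β / 4 * (4 / β) := by gcongr
    have h2 : β / 4 * (4 / β) = 1 := by field_simp
    linarith
  set Ψ : E → E := fun y => y + τ • g y t with hΨ
  have hball : Metric.closedBall (y₂ t) (Lmax / μ) ⊆ Metric.closedBall (0 : E) R := by
    refine Metric.closedBall_subset_closedBall' ?_
    rw [dist_zero_right, hR]
    linarith [hB₂ t ht]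
  -- the Euler map enlarges the mesh by at most `1 + |C|`, so finer chains are mapped
  have hmap : Reach (fun y => M y (t + τ)) (Ψ (y₁ t)) (Ψ (y₂ t)) ((1 - β / 4 * τ) * L) := by
    intro d hd
    have hΛ : 0 < 1 + |C| := by positivity
    have hd' : 0 < min δ (d / (1 + |C|)) := by positivity
    have h := (hreach _ hd').map (G' := fun y => M y (t + τ)) (Ψ := Ψ) (Λ := d / min δ (d / (1 + |C|)))
      (R := Lmax / μ) hμ (fun y => hpos y t) hρ (by positivity)
      (fun a ha b _ hab => hlink τ ⟨hτ0, hτδ⟩ t ht a (hball ha) b (hab.trans (min_le_left _ _)))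
      (fun a ha b hb => ?_) (by rw [mul_div_cancel₀ _ hμ.ne']; exact hL)
    · rwa [div_mul_cancel₀ _ hd'.ne'] at h
    · have haR : ‖a‖ ≤ R := by simpa using hball ha
      have hbR : ‖b‖ ≤ R := by simpa using hball hb
      have hmean : ‖meanFDeriv g a (b - a) t‖ ≤ |C| := by
        refine (hC (a, b - a, t) ⟨hball ha, ?_, ht⟩).trans (le_abs_self C)
        rw [mem_closedBall_zero_iff]
        exact (norm_sub_le b a).trans (by linarith)
      have heq : Ψ b - Ψ a = (b - a) + τ • meanFDeriv g a (b - a) t (b - a) := by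
        rw [meanFDeriv_apply hg, add_sub_cancel, hΨ]
        simp only [smul_sub]
        abel
      have h1 : ‖Ψ b - Ψ a‖ ≤ (1 + |C|) * ‖b - a‖ := by
        rw [heq]
        calc ‖(b - a) + τ • meanFDeriv g a (b - a) t (b - a)‖
            ≤ ‖b - a‖ + τ * (|C| * ‖b - a‖) := by
              refine (norm_add_le _ _).trans ?_
              rw [norm_smul, Real.norm_of_nonneg hτ0]
              gcongr
              exact ContinuousLinearMap.le_of_opNorm_le _ hmean _
          _ ≤ ‖b - a‖ + 1 * (|C| * ‖b - a‖) := by gcongr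
          _ = (1 + |C|) * ‖b - a‖ := by ring
      refine h1.trans (mul_le_mul_of_nonneg_right ?_ (norm_nonneg _))
      rw [le_div_iff₀ hd', mul_comm, ← le_div_iff₀ hΛ]
      exact min_le_right _ _
  -- the links at the ends
  have hr₁ := ht₁ τ ⟨hτ0, hτδ₁⟩ t ht htτ
  have hr₂ := ht₂ τ ⟨hτ0, hτδ₂⟩ t ht htτ
  set r₁ := y₁ (t + τ) - (y₁ t + τ • y₁' t) with hr₁def
  set r₂ := y₂ (t + τ) - (y₂ t + τ • g (y₂ t) t) with hr₂def
  have hετ : ε' * τ ≤ 1 := mul_le_one₀ (min_le_right _ _) hτ0 hτ1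
  have hsmall : ∀ r : E, ‖r‖ ≤ ε' * τ → (m' * ‖r‖) ^ 2 ≤ (τ * (ε / 2)) ^ 2 := by
    intro r hr
    have : m' * ‖r‖ ≤ τ * (ε / 2) := by
      calc m' * ‖r‖ ≤ m' * (ε' * τ) := by gcongr
        _ = (m' * ε') * τ := by ring
        _ ≤ (ε / 2) * τ := by gcongr
        _ = τ * (ε / 2) := by ring
    gcongr
  have hτε : 0 ≤ τ * (ε / 2) := by positivity
  have hlink₁ : Reach (fun y => M y (t + τ)) (y₁ (t + τ)) (y₁ (t + τ) + -r₁) (τ * (ε / 2)) := by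
    refine reach_segment hτε fun σ hσ => (hrest _ htτ _ ?_ _).trans
      (hsmall _ (by rwa [norm_neg]))
    rw [mem_closedBall_zero_iff]
    refine (norm_add_le _ _).trans (add_le_add ((hB₁ _ htτ).trans (le_max_left _ _)) ?_)
    rw [norm_smul, norm_neg, Real.norm_of_nonneg hσ.1]
    exact mul_le_one₀ hσ.2 (norm_nonneg _) (hr₁.trans hετ)
  have hlink₂ : Reach (fun y => M y (t + τ)) (y₁ (t + τ) + -r₁)
      (y₁ (t + τ) + -r₁ + -(τ • (y₁' t - g (y₁ t) t))) (τ * θ) := by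
    refine reach_segment (by positivity) fun σ _ => ?_
    rw [map_neg, inner_neg_neg, map_smul, inner_smul_left, inner_smul_right, mul_pow, pow_two,
      conj_trivial, mul_assoc]
    gcongr
    exact hdist t ht _ _
  have hend₁ : y₁ (t + τ) + -r₁ + -(τ • (y₁' t - g (y₁ t) t)) = Ψ (y₁ t) := by
    rw [hr₁def, hΨ]
    module
  have hlink₃ : Reach (fun y => M y (t + τ)) (Ψ (y₂ t)) (Ψ (y₂ t) + r₂) (τ * (ε / 2)) := by
    refine reach_segment hτε fun σ hσ => (hrest _ htτ _ ?_ _).trans (hsmall _ hr₂)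
    have : Ψ (y₂ t) + σ • r₂ = y₂ (t + τ) + (σ - 1) • r₂ := by
      rw [hr₂def, hΨ]
      module
    rw [this, mem_closedBall_zero_iff]
    refine (norm_add_le _ _).trans (add_le_add ((hB₂ _ htτ).trans (le_max_right _ _)) ?_)
    rw [norm_smul]
    refine mul_le_one₀ ?_ (norm_nonneg _) (hr₂.trans hετ)
    rw [Real.norm_eq_abs, abs_le]
    constructor <;> linarith [hσ.1, hσ.2]
  have hend₂ : Ψ (y₂ t) + r₂ = y₂ (t + τ) := by
    rw [hr₂def, hΨ]
    module
  rw [hend₁] at hlink₂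
  rw [hend₂] at hlink₃
  exact (((hlink₁.trans hlink₂).trans hmap).trans hlink₃).mono (le_of_eq (by ring))

/-- Along a contracting dynamics the metric distance of a disturbed trajectory `y₁` from a
trajectory `y₂` decays exponentially to a value proportional to the disturbance. -/
theorem reach_of_contracting
    (hM : SmoothMetric M) (hsa : ∀ s t, IsSelfAdjoint (M s t))
    (hg : ContDiff ℝ ∞ (fun p : E × ℝ => g p.1 p.2)) (hμ : 0 < μ)
    (hpos : ∀ s t v, μ ^ 2 * ‖v‖ ^ 2 ≤ ⟪M s t v, v⟫_ℝ) (hβ : 0 < β)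
    (hcontr : ∀ s t, contractionOp M g β s t ≤ 0) {y₁ y₁' y₂ : ℝ → E} {T₁ T₂ : ℝ}
    (hT : T₁ ≤ T₂)
    (hy₁ : ∀ t ∈ Icc T₁ T₂, HasDerivWithinAt y₁ (y₁' t) (Icc T₁ T₂) t)
    (hy₁' : ContinuousOn y₁' (Icc T₁ T₂))
    (hy₂ : ∀ t ∈ Icc T₁ T₂, HasDerivWithinAt y₂ (g (y₂ t) t) (Icc T₁ T₂) t)
    {θ : ℝ} (hθ : 0 ≤ θ) (hdist : ∀ t ∈ Icc T₁ T₂, ∀ y t',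
      ⟪M y t' (y₁' t - g (y₁ t) t), y₁' t - g (y₁ t) t⟫_ℝ ≤ θ ^ 2)
    {L₀ : ℝ} (h₀ : Reach (fun y => M y T₁) (y₁ T₁) (y₂ T₁) L₀) {ε : ℝ} (hε : 0 < ε) :
    Reach (fun y => M y T₂) (y₁ T₂) (y₂ T₂)
      (Real.exp (-(β / 4 * (T₂ - T₁))) * L₀ + (θ + ε) / (β / 4)) := by
  set b := β / 4 with hb
  have hb0 : 0 < b := by positivity
  set q := (θ + ε) / b with hq
  have hq0 : 0 ≤ q := by positivity
  have hL₀ : 0 ≤ L₀ := h₀.nonneg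
  obtain ⟨δ, hδ, hstep⟩ := exists_reach_step hM hsa hg hμ hpos hβ hcontr hy₁ hy₁' hy₂ hθ hdist
    (L₀ + q) hε
  obtain ⟨N, hN⟩ := exists_nat_gt (max ((T₂ - T₁) / min δ (1 / b)) 0)
  have hN0 : (0 : ℝ) < N := (le_max_right _ _).trans_lt hN
  have hNδ : (T₂ - T₁) / N ≤ min δ (1 / b) := by
    have h1 := ((le_max_left _ _).trans_lt hN).le
    rw [div_le_iff₀ (by positivity)] at h1
    rw [div_le_iff₀ hN0]
    linarith
  set τ := (T₂ - T₁) / N with hτ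
  have hτ0 : 0 ≤ τ := div_nonneg (by linarith) hN0.le
  have hNτ : N * τ = T₂ - T₁ := by rw [hτ]; field_simp
  have hρ0 : 0 ≤ 1 - b * τ := by
    have h1 : b * τ ≤ b * (1 / b) := by
      gcongr
      exact hNδ.trans (min_le_right _ _)
    have h2 : b * (1 / b) = 1 := by field_simp
    linarith
  have hρ1 : 1 - b * τ ≤ 1 := by linarith [mul_nonneg hb0.le hτ0]
  -- the recursion `L ↦ (1 - bτ) L + τ (θ + ε)` has the fixed point `q`
  have key : ∀ k : ℕ, k ≤ N → Reach (fun y => M y (T₁ + k * τ)) (y₁ (T₁ + k * τ))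
      (y₂ (T₁ + k * τ)) ((1 - b * τ) ^ k * (L₀ - q) + q) := by
    intro k
    induction k with
    | zero => intro _; simpa using h₀
    | succ k ih =>
      intro hk
      have hk' : ((k : ℝ) + 1) * τ ≤ N * τ := by
        gcongr
        exact_mod_cast hk
      have hk0 : 0 ≤ (k : ℝ) * τ := by positivity
      have hpow0 : 0 ≤ (1 - b * τ) ^ k := pow_nonneg hρ0 k
      have hpow1 : (1 - b * τ) ^ k ≤ 1 := pow_le_one₀ hρ0 hρ1
      have h1 := hstep τ ⟨hτ0, hNδ.trans (min_le_left _ _)⟩ (T₁ + k * τ)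
        ⟨by linarith, by linarith⟩ ⟨by linarith, by linarith⟩
        ((1 - b * τ) ^ k * (L₀ - q) + q) (by nlinarith) (ih (by omega))
      have h2 : T₁ + k * τ + τ = T₁ + (k + 1 : ℕ) * τ := by push_cast; ring
      have h3 : θ + ε = b * q := by rw [hq]; field_simp
      rw [h2, h3] at h1
      refine h1.mono (le_of_eq ?_)
      ring
  have hfin := key N le_rfl
  rw [hNτ, add_sub_cancel] at hfin
  refine hfin.mono ?_
  have hpow : (1 - b * τ) ^ N ≤ Real.exp (-(b * (T₂ - T₁))) := by
    calc (1 - b * τ) ^ N ≤ Real.exp (-(b * τ)) ^ N := by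
          gcongr
          exact Real.one_sub_le_exp_neg _
      _ = Real.exp (-(b * (T₂ - T₁))) := by
          rw [← Real.exp_nat_mul, ← hNτ]
          congr 1
          ring
  have := mul_le_mul_of_nonneg_right hpow hL₀
  nlinarith [mul_nonneg (pow_nonneg hρ0 N) hq0]

/-- Trajectories of a contracting dynamics attract every curve that satisfies the equation up to a
disturbance that vanishes at infinity; the disturbance is measured in the metric, uniformly in the
state. No upper bound on the metric is needed. -/
theorem tendsto_sub_of_contracting
    (hM : SmoothMetric M) (hpd : UniformlyPosDef M)
    (hg : ContDiff ℝ ∞ (fun p : E × ℝ => g p.1 p.2)) (hβ : 0 < β)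
    (hcontr : ∀ s t, contractionOp M g β s t ≤ 0) {y₁ y₁' y₂ : ℝ → E} {t₀ : ℝ}
    (hy₁ : ∀ t ∈ Ici t₀, HasDerivWithinAt y₁ (y₁' t) (Ici t₀) t)
    (hy₁' : ContinuousOn y₁' (Ici t₀)) (hy₂ : IsTrajectory g t₀ y₂)
    (hdist : ∀ θ > 0, ∃ T ≥ t₀, ∀ t ≥ T, ∀ y t',
      ⟪M y t' (y₁' t - g (y₁ t) t), y₁' t - g (y₁ t) t⟫_ℝ ≤ θ ^ 2) :
    Tendsto (fun t => y₁ t - y₂ t) atTop (𝓝 0) := by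
  obtain ⟨μ, hμ, hpos⟩ := hpd.exists_sq_le
  rw [Metric.tendsto_atTop]
  intro η hη
  set b := β / 4 with hb
  have hb0 : 0 < b := by positivity
  set θ := μ * η * b / 4 with hθdef
  have hθ : 0 < θ := by positivity
  obtain ⟨T₁, hT₁, hd⟩ := hdist θ hθ
  obtain ⟨L₀, hL₀⟩ := exists_reach (G := fun y => M y T₁)
    (hM.continuous.comp (f := fun y => (y, T₁)) (by fun_prop)) (y₁ T₁) (y₂ T₁)
  have hlim : Tendsto (fun t : ℝ => Real.exp (-(b * (t - T₁))) * L₀) atTop (𝓝 (0 * L₀)) := by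
    refine Tendsto.mul_const L₀ (Real.tendsto_exp_neg_atTop_nhds_zero.comp ?_)
    exact (tendsto_atTop_add_const_right atTop (-T₁) tendsto_id).const_mul_atTop hb0
  rw [zero_mul] at hlim
  obtain ⟨T₂, hT₂⟩ := ((hlim.eventually (gt_mem_nhds (show 0 < μ * η / 4 by positivity))).and
    (eventually_ge_atTop T₁)).exists_forall_of_atTop
  refine ⟨T₂, fun t ht => ?_⟩
  obtain ⟨hexp, htT⟩ := hT₂ t ht
  have hsub : Icc T₁ t ⊆ Ici t₀ := fun r hr => hT₁.le.trans hr.1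
  have hreach := reach_of_contracting hM hpd.isSelfAdjoint hg hμ hpos hβ hcontr htT
    (fun r hr => (hy₁ r (hsub hr)).mono hsub) (hy₁'.mono hsub)
    (fun r hr => (hy₂ r (hsub hr)).mono hsub) hθ.le (fun r hr => hd r hr.1) hL₀ hθ
  have hle := (hreach 1 one_pos).mul_norm_le hμ (fun y => hpos y t)
  have h2 : (θ + θ) / b = μ * η / 2 := by rw [hθdef]; field_simp; ring
  rw [← hb, h2, norm_sub_rev] at hle
  rw [dist_zero_right]
  have h3 : μ * ‖y₁ t - y₂ t‖ < μ * η := by nlinarith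
  exact lt_of_mul_lt_mul_left h3 hμ.le

end Convergence

section StronglyConvex

open scoped InnerProductSpace
open Set Filter Topology

/-! ### Minimization of strongly convex functions -/

variable {F : Type*} [NormedAddCommGroup F] [InnerProductSpace ℝ F]

theorem mul_norm_le_norm_of_le_inner {A : F →L[ℝ] F} {lam : ℝ}
    (hA : ∀ v, lam * ‖v‖ ^ 2 ≤ ⟪A v, v⟫_ℝ) (v : F) : lam * ‖v‖ ≤ ‖A v‖ := by
  rcases (norm_nonneg v).eq_or_lt with h | h
  · simp [← h]
  · refine le_of_mul_le_mul_right ?_ h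
    calc lam * ‖v‖ * ‖v‖ = lam * ‖v‖ ^ 2 := by ring
      _ ≤ ⟪A v, v⟫_ℝ := hA v
      _ ≤ ‖A v‖ * ‖v‖ := real_inner_le_norm _ _

theorem isInvertible_of_le_inner [FiniteDimensional ℝ F] {A : F →L[ℝ] F} {lam : ℝ} (hlam : 0 < lam)
    (hA : ∀ v, lam * ‖v‖ ^ 2 ≤ ⟪A v, v⟫_ℝ) : A.IsInvertible := by
  have hinj : Function.Injective (A : F →ₗ[ℝ] F) := by
    rw [← LinearMap.ker_eq_bot, LinearMap.ker_eq_bot']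
    intro v hv
    have h1 := mul_norm_le_norm_of_le_inner hA v
    have h2 : A v = 0 := hv
    rw [h2, norm_zero] at h1
    exact norm_le_zero_iff.1 (le_of_mul_le_mul_left (by simpa using h1) hlam)
  refine ⟨(LinearEquiv.ofInjectiveEndo (A : F →ₗ[ℝ] F) hinj).toContinuousLinearEquiv, ?_⟩
  ext v
  simp

/-- A vector field whose derivative is bounded below by `lam` is strongly monotone. -/
theorem mul_norm_sub_sq_le_inner {ζ : F → F} (hζ : Differentiable ℝ ζ) {lam : ℝ}
    (hH : ∀ U v, lam * ‖v‖ ^ 2 ≤ ⟪fderiv ℝ ζ U v, v⟫_ℝ) (U U' : F) :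
    lam * ‖U - U'‖ ^ 2 ≤ ⟪ζ U - ζ U', U - U'⟫_ℝ := by
  set d := U - U' with hd
  have hderiv : ∀ σ : ℝ, HasDerivAt (fun σ : ℝ => ⟪ζ (U' + σ • d), d⟫_ℝ)
      ⟪fderiv ℝ ζ (U' + σ • d) d, d⟫_ℝ σ := by
    intro σ
    have h1 : HasDerivAt (fun σ : ℝ => U' + σ • d) d σ := by
      simpa using ((hasDerivAt_id σ).smul_const d).const_add U'
    have h2 := ((hζ (U' + σ • d)).hasFDerivAt.comp_hasDerivAt σ h1).inner ℝ (hasDerivAt_const σ d)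
    simpa using h2
  have h := (convex_univ (𝕜 := ℝ) (E := ℝ)).mul_sub_le_image_sub_of_le_deriv
    (f := fun σ : ℝ => ⟪ζ (U' + σ • d), d⟫_ℝ) (C := lam * ‖d‖ ^ 2)
    (fun σ _ => (hderiv σ).continuousAt.continuousWithinAt)
    (fun σ _ => (hderiv σ).differentiableAt.differentiableWithinAt)
    (fun σ _ => by rw [(hderiv σ).deriv]; exact hH _ _) 0 (mem_univ _) 1 (mem_univ _) zero_le_one
  simp only [one_smul, zero_smul, add_zero, sub_zero, mul_one] at h
  rw [inner_sub_left]
  have : U' + d = U := by rw [hd]; abel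
  rwa [this] at h

theorem mul_norm_sub_le_norm_sub {ζ : F → F} (hζ : Differentiable ℝ ζ) {lam : ℝ}
    (hH : ∀ U v, lam * ‖v‖ ^ 2 ≤ ⟪fderiv ℝ ζ U v, v⟫_ℝ) (U U' : F) :
    lam * ‖U - U'‖ ≤ ‖ζ U - ζ U'‖ := by
  rcases (norm_nonneg (U - U')).eq_or_lt with h | h
  · simp [← h]
  · refine le_of_mul_le_mul_right ?_ h
    calc lam * ‖U - U'‖ * ‖U - U'‖ = lam * ‖U - U'‖ ^ 2 := by ring
      _ ≤ _ := mul_norm_sub_sq_le_inner hζ hH U U'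
      _ ≤ _ := real_inner_le_norm _ _

theorem gradient_eq_zero_of_isMin [CompleteSpace F] {V : F → ℝ} {U : F} (hU : ∀ U', V U ≤ V U') :
    gradient V U = 0 := by
  have hmin : IsLocalMin V U := Filter.Eventually.of_forall hU
  rw [gradient, hmin.fderiv_eq_zero, map_zero]

variable [FiniteDimensional ℝ F] {V : F → ℝ} {lam : ℝ}

/-- The lower bound of the second derivative makes `V` grow quadratically, so a minimum is attained. -/
theorem exists_minimizer (hV : Differentiable ℝ V) (hζ : Differentiable ℝ (gradient V))
    (hlam : 0 < lam) (hH : ∀ U v, lam * ‖v‖ ^ 2 ≤ ⟪fderiv ℝ (gradient V) U v, v⟫_ℝ) :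
    ∃ U, ∀ U', V U ≤ V U' := by
  have hlow : ∀ U, V 0 + ‖U‖ * (lam / 2 * ‖U‖ - ‖gradient V 0‖) ≤ V U := by
    intro U
    have hderiv : ∀ σ : ℝ, HasDerivAt
        (fun σ : ℝ => V (σ • U) - (σ * ⟪gradient V 0, U⟫_ℝ + lam / 2 * ‖U‖ ^ 2 * σ ^ 2))
        (⟪gradient V (σ • U), U⟫_ℝ - (⟪gradient V 0, U⟫_ℝ + lam / 2 * ‖U‖ ^ 2 * (2 * σ))) σ := by
      intro σ
      have h1 : HasDerivAt (fun σ : ℝ => σ • U) U σ := by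
        simpa using (hasDerivAt_id σ).smul_const U
      have h2 := (hV (σ • U)).hasGradientAt.hasFDerivAt.comp_hasDerivAt σ h1
      rw [InnerProductSpace.toDual_apply_apply] at h2
      have h3 : HasDerivAt
          (fun σ : ℝ => σ * ⟪gradient V 0, U⟫_ℝ + lam / 2 * ‖U‖ ^ 2 * σ ^ 2)
          (⟪gradient V 0, U⟫_ℝ + lam / 2 * ‖U‖ ^ 2 * (2 * σ)) σ := by
        have h4 := (hasDerivAt_pow 2 σ).const_mul (lam / 2 * ‖U‖ ^ 2)
        simpa using ((hasDerivAt_id σ).mul_const ⟪gradient V 0, U⟫_ℝ).fun_add h4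
      exact h2.fun_sub h3
    have h := (convex_Icc (0 : ℝ) 1).mul_sub_le_image_sub_of_le_deriv (C := 0)
      (fun σ _ => (hderiv σ).continuousAt.continuousWithinAt)
      (fun σ _ => (hderiv σ).differentiableAt.differentiableWithinAt)
      (fun σ hσ => by
        rw [(hderiv σ).deriv]
        rw [interior_Icc] at hσ
        have h5 := mul_norm_sub_sq_le_inner hζ hH (σ • U) 0
        rw [sub_zero, norm_smul, Real.norm_of_nonneg hσ.1.le, inner_smul_right, inner_sub_left] at h5
        have h6 : lam * σ * ‖U‖ ^ 2 ≤ ⟪gradient V (σ • U), U⟫_ℝ - ⟪gradient V 0, U⟫_ℝ := by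
          refine le_of_mul_le_mul_left ?_ hσ.1
          calc σ * (lam * σ * ‖U‖ ^ 2) = lam * (σ * ‖U‖) ^ 2 := by ring
            _ ≤ _ := h5
        linarith) 0 ⟨le_rfl, zero_le_one⟩ 1 ⟨zero_le_one, le_rfl⟩ zero_le_one
    simp only [one_smul, zero_smul] at h
    have h7 : -(‖gradient V 0‖ * ‖U‖) ≤ ⟪gradient V 0, U⟫_ℝ :=
      neg_le_of_abs_le (abs_real_inner_le_norm _ _)
    nlinarith
  have hcoer : Tendsto (fun U : F => V 0 + ‖U‖ * (lam / 2 * ‖U‖ - ‖gradient V 0‖))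
      (cocompact F) atTop := by
    have hn := tendsto_norm_cocompact_atTop (E := F)
    refine tendsto_atTop_add_const_left _ _ (hn.atTop_mul_atTop₀ ?_)
    exact tendsto_atTop_add_const_right _ _ (hn.const_mul_atTop (by positivity))
  exact hV.continuous.exists_forall_le (tendsto_atTop_mono hlow hcoer)

/-- The zero of a strongly monotone vector field depends smoothly on parameters: since it is unique,
it agrees with the implicit function. -/
theorem contDiff_zero_of_stronglyMonotone {W : Type*} [NormedAddCommGroup W] [NormedSpace ℝ W]
    [CompleteSpace W] {ζ : F → W → F} (hζ : ContDiff ℝ ∞ (fun p : F × W => ζ p.1 p.2))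
    (hlam : 0 < lam) (hH : ∀ U p v, lam * ‖v‖ ^ 2 ≤ ⟪fderiv ℝ (fun W => ζ W p) U v, v⟫_ℝ)
    {Z : W → F} (hZ : ∀ p, ζ (Z p) p = 0) : ContDiff ℝ ∞ Z := by
  rw [contDiff_iff_contDiffAt]
  intro p
  have hpart : ∀ U q, HasFDerivAt (fun W => ζ W q)
      (fderiv ℝ (fun p : F × W => ζ p.1 p.2) (U, q) ∘L ContinuousLinearMap.inl ℝ F W) U :=
    fun U q => fderiv_partial_left (hζ.contDiffAt.differentiableAt (by simp))
  set f : W × F → F := fun q => ζ q.2 q.1 with hf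
  have hfc : ContDiff ℝ ∞ f := hζ.comp (contDiff_snd.prodMk contDiff_fst)
  have hfu : f (p, Z p) = 0 := hZ p
  have hinv : (fderiv ℝ f (p, Z p) ∘L ContinuousLinearMap.inr ℝ W F).IsInvertible := by
    have h1 : HasFDerivAt (fun U => ζ U p)
        (fderiv ℝ f (p, Z p) ∘L ContinuousLinearMap.inr ℝ W F) (Z p) :=
      HasFDerivAt.comp (f := fun U : F => (p, U)) (Z p)
        (hfc.contDiffAt.differentiableAt (by simp)).hasFDerivAt
        ((hasFDerivAt_const p (Z p)).prodMk (hasFDerivAt_id (Z p)))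
    rw [← h1.fderiv]
    exact isInvertible_of_le_inner hlam (hH (Z p) p)
  have hat : ContDiffAt ℝ ∞ f (p, Z p) := hfc.contDiffAt
  refine (hat.contDiffAt_implicitFunction (by simp) hinv).congr_of_eventuallyEq ?_
  filter_upwards [hat.eventually_apply_implicitFunction (by simp) hinv] with q hq
  rw [hfu] at hq
  have h2 := mul_norm_sub_le_norm_sub (fun U => (hpart U q).differentiableAt) (fun U v => hH U q v)
    (Z q) (hat.implicitFunction (by simp) hinv q)
  rw [hZ q, show ζ (hat.implicitFunction (by simp) hinv q) q = 0 from hq, sub_zero, norm_zero] at h2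
  exact sub_eq_zero.1 (norm_le_zero_iff.1 (le_of_mul_le_mul_left (by simpa using h2) hlam))

end StronglyConvex

namespace Problem

open scoped InnerProductSpace
open Set Filter Topology

/-! ### Smoothness of the objective and of its gradient -/

variable {n m h : ℕ} (S : Problem n m h)

theorem contDiff_predict (k : ℕ) : ContDiff ℝ ∞
    (fun p : InputSeq m h × EuclideanSpace ℝ (Fin n) × ℝ => S.predict p.1 p.2.1 p.2.2 k) := by
  induction k with
  | zero => exact contDiff_fst.comp contDiff_snd
  | succ k ih =>
    by_cases hk : k < h
    · simp only [predict, hk, dite_true]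
      have hU : ContDiff ℝ ∞
          (fun p : InputSeq m h × EuclideanSpace ℝ (Fin n) × ℝ => p.1 ⟨k, hk⟩) :=
        (contDiff_piLp_apply 2).comp contDiff_fst
      have ht : ContDiff ℝ ∞
          (fun p : InputSeq m h × EuclideanSpace ℝ (Fin n) × ℝ => S.grid k p.2.2) :=
        (S.smooth_grid k).comp (contDiff_snd.comp contDiff_snd)
      exact S.smooth_fd.comp (ih.prodMk (hU.prodMk ht))
    · simpa only [predict, hk, dite_false] using ih

theorem contDiff_V : ContDiff ℝ ∞
    (fun p : InputSeq m h × EuclideanSpace ℝ (Fin n) × ℝ => S.V p.1 p.2.1 p.2.2) := by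
  have ht : ∀ k, ContDiff ℝ ∞
      (fun p : InputSeq m h × EuclideanSpace ℝ (Fin n) × ℝ => S.grid k p.2.2) := fun k =>
    (S.smooth_grid k).comp (contDiff_snd.comp contDiff_snd)
  unfold V
  refine (S.smooth_Φ.comp ((S.contDiff_predict h).prodMk (ht h))).add (ContDiff.sum fun k _ => ?_)
  have hU : ContDiff ℝ ∞
      (fun p : InputSeq m h × EuclideanSpace ℝ (Fin n) × ℝ => p.1 k) :=
    (contDiff_piLp_apply 2).comp contDiff_fst
  exact S.smooth_ℓ.comp ((S.contDiff_predict k).prodMk (hU.prodMk (ht k)))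

theorem contDiff_ζ : ContDiff ℝ ∞
    (fun p : InputSeq m h × EuclideanSpace ℝ (Fin n) × ℝ => S.ζ p.1 p.2.1 p.2.2) := by
  have h1 : ContDiff ℝ ∞ (fun p : InputSeq m h × EuclideanSpace ℝ (Fin n) × ℝ =>
      fderiv ℝ (fun W => S.V W p.2.1 p.2.2) p.1) :=
    ContDiff.fderiv (n := ∞) (f := fun p : InputSeq m h × EuclideanSpace ℝ (Fin n) × ℝ =>
      fun W => S.V W p.2.1 p.2.2)
      (S.contDiff_V.comp (contDiff_snd.prodMk (contDiff_snd.comp contDiff_fst))) contDiff_fst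
      (by simp)
  exact (InnerProductSpace.toDual ℝ (InputSeq m h)).symm.toContinuousLinearEquiv.contDiff.comp h1

end Problem

/-! ### The closed loop in abstract inner product spaces -/

/-- A closed loop of the continuation method, reduced to what the analysis of it uses: the plant `f`
with state in `E` and input in `G`, the map `ζ` whose zero `Uopt` is followed by the variable
`U : F`, the virtual dynamics `η`, and the projection `proj` of `U` to the applied input. -/
structure Loop (E F G : Type*) [NormedAddCommGroup E] [InnerProductSpace ℝ E]
    [NormedAddCommGroup F] [InnerProductSpace ℝ F] [NormedAddCommGroup G] [InnerProductSpace ℝ G] where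
  f : E → G → ℝ → E
  ζ : F → E → ℝ → F
  η : F → ℝ → F
  proj : F →L[ℝ] G
  Uopt : E → ℝ → F
  lam : ℝ
  smooth_f : ContDiff ℝ ∞ (fun p : E × G × ℝ => f p.1 p.2.1 p.2.2)
  smooth_ζ : ContDiff ℝ ∞ (fun p : F × E × ℝ => ζ p.1 p.2.1 p.2.2)
  smooth_η : ContDiff ℝ ∞ (fun p : F × ℝ => η p.1 p.2)
  lam_pos : 0 < lam
  le_H : ∀ U x t v, lam * ‖v‖ ^ 2 ≤ inner ℝ (fderiv ℝ (fun W => ζ W x t) U v) v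
  ζ_Uopt : ∀ x t, ζ (Uopt x t) x t = 0

namespace Loop

open scoped InnerProductSpace
open Set Filter Topology

variable {E F G : Type*} [NormedAddCommGroup E] [InnerProductSpace ℝ E]
  [NormedAddCommGroup F] [InnerProductSpace ℝ F] [NormedAddCommGroup G] [InnerProductSpace ℝ G]
  (S : Loop E F G)

/-- `∂ζ/∂U`. -/
noncomputable def H (U : F) (x : E) (t : ℝ) : F →L[ℝ] F := fderiv ℝ (fun W => S.ζ W x t) U

/-- `∂ζ/∂x`. -/
noncomputable def ζx (U : F) (x : E) (t : ℝ) : E →L[ℝ] F := fderiv ℝ (fun y => S.ζ U y t) x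

/-- `∂ζ/∂s` for `s = [x; U]`. -/
noncomputable def ζs (s : WithLp 2 (E × F)) (t : ℝ) : WithLp 2 (E × F) →L[ℝ] F :=
  fderiv ℝ (fun r : WithLp 2 (E × F) => S.ζ r.snd r.fst t) s

/-- `K = - H⁻¹ ∂ζ/∂x - ∂U*/∂x`. -/
noncomputable def K (U : F) (x : E) (t : ℝ) : E →L[ℝ] F :=
  -((S.H U x t).inverse ∘L S.ζx U x t) - fderiv ℝ (fun y => S.Uopt y t) x

/-- The right-hand side `η(ζ, t) - ∂ζ/∂x f - ∂ζ/∂t` of the equation `H U̇ = b`. -/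
noncomputable def b (U : F) (x : E) (t : ℝ) : F :=
  S.η (S.ζ U x t) t - S.ζx U x t (S.f x (S.proj U) t) - deriv (fun τ => S.ζ U x τ) t

/-- The closed loop `φ(s, t) = [f; H⁻¹ b]`. -/
noncomputable def φ (s : WithLp 2 (E × F)) (t : ℝ) : WithLp 2 (E × F) :=
  WithLp.toLp 2 (S.f s.fst (S.proj s.snd) t, (S.H s.snd s.fst t).inverse (S.b s.snd s.fst t))

/-- The plant controlled by the optimal input and the residual input `ur`. -/
def fr (x : E) (ur : G) (t : ℝ) : E := S.f x (S.proj (S.Uopt x t) + ur) t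

/-- The residual input. -/
def residual (U : F) (x : E) (t : ℝ) : G := S.proj U - S.proj (S.Uopt x t)

theorem differentiableAt_ζ (p : F × E × ℝ) : DifferentiableAt ℝ
    (fun p : F × E × ℝ => S.ζ p.1 p.2.1 p.2.2) p :=
  S.smooth_ζ.contDiffAt.differentiableAt (by simp)

/-- The derivative of `ζ` in all its variables `(U, x, t)`. -/
noncomputable def dζ (U : F) (x : E) (t : ℝ) :
    F × E × ℝ →L[ℝ] F :=
  fderiv ℝ (fun p : F × E × ℝ => S.ζ p.1 p.2.1 p.2.2) (U, x, t)

theorem hasFDerivAt_ζ_U (U : F) (x : E) (t : ℝ) :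
    HasFDerivAt (fun W => S.ζ W x t) (S.dζ U x t ∘L ContinuousLinearMap.inl ℝ _ _) U :=
  HasFDerivAt.comp (f := fun W : F => (W, x, t)) U
    (S.differentiableAt_ζ (U, x, t)).hasFDerivAt
    ((hasFDerivAt_id U).prodMk (hasFDerivAt_const (x, t) U))

theorem H_eq (U : F) (x : E) (t : ℝ) :
    S.H U x t = S.dζ U x t ∘L ContinuousLinearMap.inl ℝ _ _ :=
  (S.hasFDerivAt_ζ_U U x t).fderiv

theorem ζx_eq (U : F) (x : E) (t : ℝ) :
    S.ζx U x t = S.dζ U x t ∘L ContinuousLinearMap.inr ℝ _ _ ∘L ContinuousLinearMap.inl ℝ _ _ := by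
  have h1 : HasFDerivAt (fun y => S.ζ U y t)
      (S.dζ U x t ∘L (0 : E →L[ℝ] F).prod ((ContinuousLinearMap.id ℝ E).prod 0)) x :=
    HasFDerivAt.comp (f := fun y : E => (U, y, t)) x (S.differentiableAt_ζ (U, x, t)).hasFDerivAt
      ((hasFDerivAt_const U x).prodMk ((hasFDerivAt_id x).prodMk (hasFDerivAt_const t x)))
  rw [ζx, h1.fderiv]
  rfl

theorem deriv_ζ_eq (U : F) (x : E) (t : ℝ) :
    deriv (fun τ => S.ζ U x τ) t = S.dζ U x t (0, 0, 1) :=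
  HasDerivAt.deriv <| HasFDerivAt.comp_hasDerivAt (f := fun τ : ℝ => (U, x, τ)) t
    (S.differentiableAt_ζ (U, x, t)).hasFDerivAt
    ((hasDerivAt_const t U).prodMk ((hasDerivAt_const t x).prodMk (hasDerivAt_id t)))

theorem dζ_apply (U : F) (x : E) (t : ℝ) (V : F)
    (y : E) (r : ℝ) :
    S.dζ U x t (V, y, r) = S.H U x t V + S.ζx U x t y + r • deriv (fun τ => S.ζ U x τ) t := by
  rw [H_eq, ζx_eq, deriv_ζ_eq, ← map_smul]
  simp only [ContinuousLinearMap.comp_apply, ← map_add]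
  simp

theorem contDiff_dζ : ContDiff ℝ ∞
    (fun p : F × E × ℝ => S.dζ p.1 p.2.1 p.2.2) :=
  S.smooth_ζ.fderiv_right (by simp)

theorem contDiff_H : ContDiff ℝ ∞
    (fun p : F × E × ℝ => S.H p.1 p.2.1 p.2.2) := by
  simp only [H_eq]
  exact S.contDiff_dζ.clm_comp contDiff_const

theorem contDiff_ζx : ContDiff ℝ ∞
    (fun p : F × E × ℝ => S.ζx p.1 p.2.1 p.2.2) := by
  simp only [ζx_eq]
  exact S.contDiff_dζ.clm_comp contDiff_const

theorem contDiff_deriv_ζ : ContDiff ℝ ∞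
    (fun p : F × E × ℝ =>
      deriv (fun τ => S.ζ p.1 p.2.1 τ) p.2.2) := by
  simp only [deriv_ζ_eq]
  exact S.contDiff_dζ.clm_apply contDiff_const

/-- The coordinates `s = [x; U] ↦ (U, x)` of the closed loop, followed by time. -/
theorem contDiff_loopCoord : ContDiff ℝ ∞
    (fun p : WithLp 2 (E × F) × ℝ => (p.1.snd, p.1.fst, p.2)) :=
  ((WithLp.sndL 2 ℝ E F).contDiff.comp contDiff_fst).prodMk
    (((WithLp.fstL 2 ℝ E F).contDiff.comp contDiff_fst).prodMk
      contDiff_snd)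

theorem contDiff_ζ_loop : ContDiff ℝ ∞
    (fun p : WithLp 2 (E × F) × ℝ => S.ζ p.1.snd p.1.fst p.2) :=
  S.smooth_ζ.comp contDiff_loopCoord

theorem fderiv_ζ_loop (s : WithLp 2 (E × F)) (t : ℝ) (v : WithLp 2 (E × F)) (r : ℝ) :
    fderiv ℝ (fun p : WithLp 2 (E × F) × ℝ => S.ζ p.1.snd p.1.fst p.2) (s, t) (v, r)
      = S.dζ s.snd s.fst t (v.snd, v.fst, r) := by
  have h1 : HasFDerivAt (fun p : WithLp 2 (E × F) × ℝ => (p.1.snd, p.1.fst, p.2))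
      (((WithLp.sndL 2 ℝ E F) ∘L
        ContinuousLinearMap.fst ℝ _ _).prod
        (((WithLp.fstL 2 ℝ E F) ∘L
          ContinuousLinearMap.fst ℝ _ _).prod (ContinuousLinearMap.snd ℝ _ _))) (s, t) :=
    ((WithLp.sndL 2 ℝ E F).hasFDerivAt.comp (s, t) hasFDerivAt_fst).prodMk
      (((WithLp.fstL 2 ℝ E F).hasFDerivAt.comp (s, t) hasFDerivAt_fst).prodMk hasFDerivAt_snd)
  have h2 := (S.differentiableAt_ζ (s.snd, s.fst, t)).hasFDerivAt.comp (s, t) h1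
  rw [HasFDerivAt.fderiv (f := fun p : WithLp 2 (E × F) × ℝ => S.ζ p.1.snd p.1.fst p.2) h2]
  rfl

theorem ζs_eq (s : WithLp 2 (E × F)) (t : ℝ) :
    S.ζs s t = fderiv ℝ (fun p : WithLp 2 (E × F) × ℝ => S.ζ p.1.snd p.1.fst p.2) (s, t) ∘L
      ContinuousLinearMap.inl ℝ _ _ :=
  (fderiv_partial_left (f := fun (r : WithLp 2 (E × F)) τ => S.ζ r.snd r.fst τ)
    (S.contDiff_ζ_loop.contDiffAt.differentiableAt (by simp))).fderiv

theorem ζs_apply (s : WithLp 2 (E × F)) (t : ℝ) (v : WithLp 2 (E × F)) :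
    S.ζs s t v = S.H s.snd s.fst t v.snd + S.ζx s.snd s.fst t v.fst := by
  rw [ζs_eq, ContinuousLinearMap.comp_apply, ContinuousLinearMap.inl_apply, fderiv_ζ_loop, dζ_apply]
  simp

theorem contDiff_ζs : ContDiff ℝ ∞ (fun p : WithLp 2 (E × F) × ℝ => S.ζs p.1 p.2) := by
  simp only [ζs_eq]
  exact (S.contDiff_ζ_loop.fderiv_right (by simp)).clm_comp contDiff_const

variable [FiniteDimensional ℝ F]

theorem contDiff_Uopt [CompleteSpace E] : ContDiff ℝ ∞ (fun p : E × ℝ => S.Uopt p.1 p.2) :=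
  contDiff_zero_of_stronglyMonotone (ζ := fun U p => S.ζ U p.1 p.2) S.smooth_ζ S.lam_pos
    (fun U p v => S.le_H U p.1 p.2 v) fun p => S.ζ_Uopt p.1 p.2

theorem contDiff_fr [CompleteSpace E] (ur : G) :
    ContDiff ℝ ∞ (fun p : E × ℝ => S.fr p.1 ur p.2) :=
  S.smooth_f.comp (contDiff_fst.prodMk
    (((S.proj.contDiff.comp S.contDiff_Uopt).add contDiff_const).prodMk
      contDiff_snd))

theorem isInvertible_H (U : F)
    (x : E) (t : ℝ) : (S.H U x t).IsInvertible :=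
  isInvertible_of_le_inner S.lam_pos (S.le_H U x t)

theorem contDiff_inverse_H : ContDiff ℝ ∞
    (fun p : F × E × ℝ => (S.H p.1 p.2.1 p.2.2).inverse) := by
  rw [contDiff_iff_contDiffAt]
  intro p
  obtain ⟨e, he⟩ := S.isInvertible_H p.1 p.2.1 p.2.2
  have h1 : ContDiffAt ℝ ∞ ContinuousLinearMap.inverse (S.H p.1 p.2.1 p.2.2) := by
    rw [← he]
    exact contDiffAt_map_inverse e
  exact h1.comp p S.contDiff_H.contDiffAt

theorem norm_inverse_H_apply_le (U : F)
    (x : E) (t : ℝ) (z : F) :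
    S.lam * ‖(S.H U x t).inverse z‖ ≤ ‖z‖ := by
  have h1 : S.lam * _ ≤ ‖S.H U x t _‖ :=
    mul_norm_le_norm_of_le_inner (S.le_H U x t) ((S.H U x t).inverse z)
  rwa [(S.isInvertible_H U x t).self_apply_inverse] at h1

theorem contDiff_φ :
    ContDiff ℝ ∞ (fun p : WithLp 2 (E × F) × ℝ => S.φ p.1 p.2) := by
  have hf : ContDiff ℝ ∞ (fun p : F × E × ℝ =>
      S.f p.2.1 (S.proj p.1) p.2.2) :=
    S.smooth_f.comp (f := fun p : F × E × ℝ =>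
      (p.2.1, S.proj p.1, p.2.2)) (by fun_prop)
  have hη : ContDiff ℝ ∞ (fun p : F × E × ℝ =>
      S.η (S.ζ p.1 p.2.1 p.2.2) p.2.2) :=
    S.smooth_η.comp (S.smooth_ζ.prodMk (by fun_prop))
  have hb : ContDiff ℝ ∞ (fun p : F × E × ℝ =>
      S.b p.1 p.2.1 p.2.2) :=
    (hη.sub (S.contDiff_ζx.clm_apply hf)).sub S.contDiff_deriv_ζ
  have h1 := (hf.prodMk (S.contDiff_inverse_H.clm_apply hb)).comp
    (contDiff_loopCoord (E := E) (F := F))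
  exact (WithLp.prodContinuousLinearEquiv 2 ℝ E F).symm.contDiff.comp h1

/-- Along the closed loop, `ζ` follows the virtual dynamics `ż = η(z, t)`. -/
theorem fderiv_ζ_loop_φ (s : WithLp 2 (E × F)) (t : ℝ) :
    fderiv ℝ (fun p : WithLp 2 (E × F) × ℝ => S.ζ p.1.snd p.1.fst p.2) (s, t) (S.φ s t, 1)
      = S.η (S.ζ s.snd s.fst t) t := by
  rw [fderiv_ζ_loop, dζ_apply, one_smul]
  simp only [φ, WithLp.toLp_fst, WithLp.toLp_snd,
    (S.isInvertible_H s.snd s.fst t).self_apply_inverse, b]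
  abel

/-- The variation of the plant along a variation `v` of the closed-loop state, split into the part
that keeps the residual input fixed and the part due to the variation of the residual input. -/
theorem fderiv_φ_fst [CompleteSpace E] (s : WithLp 2 (E × F)) (t : ℝ) (v : WithLp 2 (E × F)) :
    (fderiv ℝ (fun r => S.φ r t) s v).fst
      = fderiv ℝ (fun y => S.fr y (S.residual s.snd s.fst t) t) s.fst v.fst
        + fderiv ℝ (fun μ => S.fr s.fst μ t) (S.residual s.snd s.fst t)
          (S.proj (S.K s.snd s.fst t v.fst
            + (S.H s.snd s.fst t).inverse (S.ζs s t v))) := by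
  set x := s.fst with hx
  set U := s.snd with hU
  set ur := S.residual U x t with hur
  have hres : S.proj (S.Uopt x t) + ur = S.proj U := by
    rw [hur, residual]; abel
  set D := fderiv ℝ (fun p : E × G × ℝ =>
    S.f p.1 p.2.1 p.2.2) (x, S.proj U, t) with hD
  have hfd : HasFDerivAt (fun p : E × G × ℝ =>
      S.f p.1 p.2.1 p.2.2) D (x, S.proj U, t) :=
    (S.smooth_f.contDiffAt.differentiableAt (by simp)).hasFDerivAt
  have hUo : HasFDerivAt (fun y => S.Uopt y t) (fderiv ℝ (fun y => S.Uopt y t) x) x :=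
    ((S.contDiff_Uopt.comp
      (contDiff_prodMk_left t)).contDiffAt.differentiableAt (by simp)).hasFDerivAt
  -- the three partial variations, through the derivative `D` of the plant
  have h1 : (fderiv ℝ (fun r => S.φ r t) s v).fst = D (v.fst, S.proj v.snd, 0) := by
    have hφ : HasFDerivAt (fun r => S.φ r t) (fderiv ℝ (fun r => S.φ r t) s) s :=
      ((S.contDiff_φ.comp
        (contDiff_prodMk_left t)).contDiffAt.differentiableAt (by simp)).hasFDerivAt
    have ha := (WithLp.fstL 2 ℝ E F).hasFDerivAt.comp s hφ
    have hb : HasFDerivAt (fun r : WithLp 2 (E × F) => (r.fst, S.proj r.snd, t))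
        ((WithLp.fstL 2 ℝ E F).prod
          ((S.proj ∘L WithLp.sndL 2 ℝ E F).prod 0))
        s :=
      (WithLp.fstL 2 ℝ E F).hasFDerivAt.prodMk
        ((S.proj ∘L WithLp.sndL 2 ℝ E F).hasFDerivAt.prodMk (hasFDerivAt_const t s))
    have hc := HasFDerivAt.comp s hfd hb
    exact congrArg (fun L => L v) (ha.unique hc)
  have h2 : fderiv ℝ (fun y => S.fr y ur t) x v.fst
      = D (v.fst, S.proj (fderiv ℝ (fun y => S.Uopt y t) x v.fst), 0) := by
    have hb : HasFDerivAt (fun y => (y, S.proj (S.Uopt y t) + ur, t))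
        ((ContinuousLinearMap.id ℝ _).prod
          ((S.proj ∘L fderiv ℝ (fun y => S.Uopt y t) x).prod 0)) x :=
      (hasFDerivAt_id x).prodMk
        (((S.proj.hasFDerivAt.comp x hUo).add_const ur).prodMk (hasFDerivAt_const t x))
    rw [← hres] at hfd
    have hc : HasFDerivAt (fun y => S.fr y ur t) _ x :=
      HasFDerivAt.comp (f := fun y => (y, S.proj (S.Uopt y t) + ur, t)) x hfd hb
    rw [hc.fderiv]
    rfl
  have h3 : ∀ w, fderiv ℝ (fun μ => S.fr x μ t) ur w = D (0, w, 0) := by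
    intro w
    have hb : HasFDerivAt (fun μ => (x, S.proj (S.Uopt x t) + μ, t))
        ((0 : G →L[ℝ] E).prod
          ((ContinuousLinearMap.id ℝ _).prod 0)) ur :=
      (hasFDerivAt_const x ur).prodMk
        (((hasFDerivAt_id ur).const_add _).prodMk (hasFDerivAt_const t ur))
    rw [← hres] at hfd
    have hc : HasFDerivAt (fun μ => S.fr x μ t) _ ur :=
      HasFDerivAt.comp (f := fun μ => (x, S.proj (S.Uopt x t) + μ, t)) ur hfd hb
    rw [hc.fderiv]
    rfl
  have h4 : S.K U x t v.fst + (S.H U x t).inverse (S.ζs s t v)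
      = v.snd - fderiv ℝ (fun y => S.Uopt y t) x v.fst := by
    rw [ζs_apply, map_add, (S.isInvertible_H _ _ _).inverse_apply_self]
    simp only [K, _root_.sub_apply, _root_.neg_apply, ContinuousLinearMap.comp_apply]
    abel
  rw [h1, h2, h3, h4, ← map_add, map_sub]
  simp

/-- The variational equation of `ż = η(z, t)`, pulled back to the closed loop: with
`a(s, t) = ∂ζ/∂s v`, the derivative of `a` along the closed loop is
`∂η/∂z a - ∂ζ/∂s ∂φ/∂s v`. It follows from the symmetry of the second derivative of `ζ`. -/
theorem fderiv_ζs_apply (s : WithLp 2 (E × F)) (t : ℝ) (v : WithLp 2 (E × F)) :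
    fderiv ℝ (fun p : WithLp 2 (E × F) × ℝ => S.ζs p.1 p.2) (s, t) (S.φ s t, 1) v
      = fderiv ℝ (fun z => S.η z t) (S.ζ s.snd s.fst t) (S.ζs s t v)
        - S.ζs s t (fderiv ℝ (fun r => S.φ r t) s v) := by
  set Z : WithLp 2 (E × F) × ℝ → F := fun p => S.ζ p.1.snd p.1.fst p.2 with hZ
  have hZc : ContDiff ℝ ∞ Z := S.contDiff_ζ_loop
  have hdZ : DifferentiableAt ℝ (fderiv ℝ Z) (s, t) :=
    (hZc.fderiv_right (m := ∞) (by simp)).contDiffAt.differentiableAt (by simp)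
  set D₂ := fderiv ℝ (fderiv ℝ Z) (s, t) with hD₂
  have hsymm : ∀ a b, D₂ a b = D₂ b a := by
    have : IsSymmSndFDerivAt ℝ Z (s, t) := (hZc.contDiffAt (n := ∞)).isSymmSndFDerivAt (by
      rw [minSmoothness_of_isRCLikeNormedField]
      exact WithTop.coe_le_coe.2 (le_top : (2 : ℕ∞) ≤ ⊤))
    exact this
  have h1 : fderiv ℝ (fun p : WithLp 2 (E × F) × ℝ => S.ζs p.1 p.2) (s, t) (S.φ s t, 1) v
      = D₂ (S.φ s t, 1) (v, 0) := by
    have ha := hdZ.hasFDerivAt.clm_comp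
      (hasFDerivAt_const (ContinuousLinearMap.inl ℝ (WithLp 2 (E × F)) ℝ) (s, t))
    simp only [S.ζs_eq]
    rw [ha.fderiv]
    simp [hD₂]
  have hφ : HasFDerivAt (fun r => S.φ r t) (fderiv ℝ (fun r => S.φ r t) s) s :=
    ((S.contDiff_φ.comp
      (contDiff_prodMk_left t)).contDiffAt.differentiableAt (by simp)).hasFDerivAt
  have hη : HasFDerivAt (fun z => S.η z t) (fderiv ℝ (fun z => S.η z t) (S.ζ s.snd s.fst t))
      (S.ζ s.snd s.fst t) :=
    ((S.smooth_η.comp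
      (contDiff_prodMk_left t)).contDiffAt.differentiableAt (by simp)).hasFDerivAt
  -- differentiate `DZ(r, t) (φ(r, t), 1) = η(Z(r, t), t)` in `r` along `v`
  have hline : HasDerivAt (fun ρ : ℝ => s + ρ • v) v 0 := by
    simpa using ((hasDerivAt_id (0 : ℝ)).smul_const v).const_add s
  have hs0 : s + (0 : ℝ) • v = s := by simp
  have hlineT : HasDerivAt (fun ρ : ℝ => (s + ρ • v, t)) (v, (0 : ℝ)) 0 :=
    hline.prodMk (hasDerivAt_const _ _)
  have hL₁ : HasDerivAt (fun ρ : ℝ => fderiv ℝ Z (s + ρ • v, t)) (D₂ (v, 0)) 0 :=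
    HasFDerivAt.comp_hasDerivAt (l := fderiv ℝ Z) (f := fun ρ : ℝ => (s + ρ • v, t)) 0
      (by rw [hs0]; exact hdZ.hasFDerivAt) hlineT
  have hL₂ : HasDerivAt (fun ρ : ℝ => (S.φ (s + ρ • v) t, (1 : ℝ)))
      (fderiv ℝ (fun r => S.φ r t) s v, (0 : ℝ)) 0 :=
    (HasFDerivAt.comp_hasDerivAt (l := fun r => S.φ r t) 0 (by rw [hs0]; exact hφ) hline).prodMk
      (hasDerivAt_const _ _)
  have hL := hL₁.clm_apply hL₂
  have hR₁ : HasDerivAt (fun ρ : ℝ => Z (s + ρ • v, t)) (S.ζs s t v) 0 := by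
    rw [S.ζs_eq]
    exact HasFDerivAt.comp_hasDerivAt (l := Z) (f := fun ρ : ℝ => (s + ρ • v, t)) 0
      (by rw [hs0]; exact (hZc.contDiffAt.differentiableAt (by simp)).hasFDerivAt) hlineT
  have hR : HasDerivAt (fun ρ : ℝ => S.η (Z (s + ρ • v, t)) t)
      (fderiv ℝ (fun z => S.η z t) (S.ζ s.snd s.fst t) (S.ζs s t v)) 0 :=
    HasFDerivAt.comp_hasDerivAt (l := fun z => S.η z t) (f := fun ρ : ℝ => Z (s + ρ • v, t)) 0
      (by simp only [hs0]; exact hη) hR₁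
  have hEq : (fun ρ : ℝ => S.η (Z (s + ρ • v, t)) t)
      = fun ρ : ℝ => fderiv ℝ Z (s + ρ • v, t) (S.φ (s + ρ • v) t, 1) := by
    funext ρ
    exact (S.fderiv_ζ_loop_φ (s + ρ • v) t).symm
  rw [hEq] at hR
  have h2 := hR.unique hL
  rw [hs0] at h2
  have h3 : S.ζs s t (fderiv ℝ (fun r => S.φ r t) s v)
      = fderiv ℝ Z (s, t) (fderiv ℝ (fun r => S.φ r t) s v, 0) := by
    rw [S.ζs_eq]
    rfl
  rw [h1, h2, h3, hsymm]
  abel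

end Loop

namespace Loop

open scoped InnerProductSpace
open Set Filter Topology

variable {E F G : Type*} [NormedAddCommGroup E] [InnerProductSpace ℝ E]
  [NormedAddCommGroup F] [InnerProductSpace ℝ F] [NormedAddCommGroup G] [InnerProductSpace ℝ G]
  [FiniteDimensional ℝ E] [FiniteDimensional ℝ F] (S : Loop E F G)

/-! ### The metric of the closed loop -/

/-- The metric `M = [P 0; 0 0] + κ (∂ζ/∂s)ᵀ Q(ζ, t) ∂ζ/∂s`. -/
noncomputable def metric (P : E → ℝ → (E →L[ℝ] E)) (Q : F → ℝ → (F →L[ℝ] F)) (κ : ℝ)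
    (s : WithLp 2 (E × F)) (t : ℝ) : WithLp 2 (E × F) →L[ℝ] WithLp 2 (E × F) :=
  ContinuousLinearMap.adjoint (WithLp.fstL 2 ℝ E F) ∘L P s.fst t ∘L WithLp.fstL 2 ℝ E F
    + κ • (ContinuousLinearMap.adjoint (S.ζs s t) ∘L Q (S.ζ s.snd s.fst t) t ∘L S.ζs s t)

/-- `P_{xU} = P ∂f_r/∂u_r Π₀`. -/
noncomputable def PxU (P : E → ℝ → (E →L[ℝ] E)) (x : E) (ur : G) (t : ℝ) : F →L[ℝ] E :=
  P x t ∘L fderiv ℝ (fun v => S.fr x v t) ur ∘L S.proj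

variable {S} {P : E → ℝ → (E →L[ℝ] E)} {Q : F → ℝ → (F →L[ℝ] F)} {κ : ℝ}

theorem inner_metric (s : WithLp 2 (E × F)) (t : ℝ) (v w : WithLp 2 (E × F)) :
    ⟪S.metric P Q κ s t v, w⟫_ℝ = ⟪P s.fst t v.fst, w.fst⟫_ℝ
      + κ * ⟪Q (S.ζ s.snd s.fst t) t (S.ζs s t v), S.ζs s t w⟫_ℝ := by
  simp only [metric, _root_.add_apply, _root_.smul_apply, ContinuousLinearMap.comp_apply,
    inner_add_left, inner_smul_left, ContinuousLinearMap.adjoint_inner_left, conj_trivial]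
  rfl

theorem isSelfAdjoint_metric (hP : ∀ x t, IsSelfAdjoint (P x t))
    (hQ : ∀ z t, IsSelfAdjoint (Q z t)) (s : WithLp 2 (E × F)) (t : ℝ) :
    IsSelfAdjoint (S.metric P Q κ s t) := by
  rw [ContinuousLinearMap.isSelfAdjoint_iff_isSymmetric]
  intro v w
  have h1 : ⟪P s.fst t v.fst, w.fst⟫_ℝ = ⟪v.fst, P s.fst t w.fst⟫_ℝ := (hP _ _).isSymmetric _ _
  have h2 : ⟪Q (S.ζ s.snd s.fst t) t (S.ζs s t v), S.ζs s t w⟫_ℝ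
      = ⟪S.ζs s t v, Q (S.ζ s.snd s.fst t) t (S.ζs s t w)⟫_ℝ := (hQ _ _).isSymmetric _ _
  simp only [ContinuousLinearMap.coe_coe]
  rw [inner_metric, real_inner_comm (S.metric P Q κ s t w), inner_metric, h1, h2,
    real_inner_comm (P s.fst t w.fst), real_inner_comm (Q _ t (S.ζs s t w))]

theorem smoothMetric_metric (hP : SmoothMetric P) (hQ : SmoothMetric Q) :
    SmoothMetric (S.metric P Q κ) := by
  have hx : ContDiff ℝ ∞ (fun p : WithLp 2 (E × F) × ℝ => p.1.fst) :=
    (WithLp.fstL 2 ℝ E F).contDiff.comp contDiff_fst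
  have h1 : ContDiff ℝ ∞ (fun p : WithLp 2 (E × F) × ℝ => P p.1.fst p.2) :=
    hP.comp (hx.prodMk contDiff_snd)
  have h2 : ContDiff ℝ ∞ (fun p : WithLp 2 (E × F) × ℝ => Q (S.ζ p.1.snd p.1.fst p.2) p.2) :=
    hQ.comp (S.contDiff_ζ_loop.prodMk contDiff_snd)
  have h3 : ContDiff ℝ ∞ (fun p : WithLp 2 (E × F) × ℝ =>
      ContinuousLinearMap.adjoint (S.ζs p.1 p.2)) :=
    (ContinuousLinearMap.adjoint (𝕜 := ℝ) (E := WithLp 2 (E × F))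
      (F := F)).toContinuousLinearEquiv.contDiff.comp S.contDiff_ζs
  exact (contDiff_const.clm_comp (h1.clm_comp contDiff_const)).add
    ((h3.clm_comp (h2.clm_comp S.contDiff_ζs)).const_smul κ)

/-- The contraction form of the metric decouples in the coordinates `v.fst` and `∂ζ/∂s v`, up to one
cross term. -/
theorem inner_contractionOp_metric (hPs : SmoothMetric P) (hP : ∀ x t, IsSelfAdjoint (P x t))
    (hQs : SmoothMetric Q) (hQ : ∀ z t, IsSelfAdjoint (Q z t)) (γ : ℝ) (s : WithLp 2 (E × F))
    (t : ℝ) (v : WithLp 2 (E × F)) :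
    ⟪contractionOp (S.metric P Q κ) S.φ γ s t v, v⟫_ℝ
      = ⟪contractionOp P (fun y τ => S.fr y (S.residual s.snd s.fst t) τ) γ s.fst t v.fst, v.fst⟫_ℝ
        + ⟪symPart (S.PxU P s.fst (S.residual s.snd s.fst t) t ∘L S.K s.snd s.fst t) v.fst, v.fst⟫_ℝ
        + 2 * ⟪P s.fst t v.fst, fderiv ℝ (fun μ => S.fr s.fst μ t) (S.residual s.snd s.fst t)
            (S.proj ((S.H s.snd s.fst t).inverse (S.ζs s t v)))⟫_ℝ
        + κ * ⟪contractionOp Q S.η γ (S.ζ s.snd s.fst t) t (S.ζs s t v), S.ζs s t v⟫_ℝ := by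
  have hMs : SmoothMetric (S.metric P Q κ) := smoothMetric_metric hPs hQs
  set x := s.fst with hx
  set U := s.snd with hU
  set ur := S.residual U x t with hur
  set a := S.ζs s t v with ha
  set z := S.ζ U x t with hz
  have hfr : S.fr x ur t = (S.φ s t).fst := by
    have : S.proj (S.Uopt x t) + ur = S.proj U := by rw [hur, residual]; abel
    rw [fr, this]
    rfl
  rw [inner_contractionOp hMs (isSelfAdjoint_metric hP hQ), inner_contractionOp hPs hP,
    inner_contractionOp hQs hQ, inner_symPart]
  -- the derivative of the quadratic form along the closed loop
  have hM := (hasDerivAt_line s t (S.φ s t) (hMs.contDiffAt.differentiableAt (by simp))).clm_apply (hasDerivAt_const 0 v)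
  have hM' := hM.inner ℝ (hasDerivAt_const 0 v)
  have hA := (hasDerivAt_line s t (S.φ s t) (S.contDiff_ζs.contDiffAt.differentiableAt (by simp))).clm_apply
    (hasDerivAt_const 0 v)
  have hx' : HasDerivAt (fun r : ℝ => (s + r • S.φ s t).fst) (S.fr x ur t) 0 := by
    rw [hfr]
    have := (hasDerivAt_line (l := fun p => p.1) s t (S.φ s t) differentiableAt_fst)
    rw [fderiv_fst] at this
    exact (WithLp.fstL 2 ℝ E F).hasFDerivAt.comp_hasDerivAt 0 this
  have ht' : HasDerivAt (fun r : ℝ => t + r) 1 0 := by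
    simpa using (hasDerivAt_id (0 : ℝ)).const_add t
  have hPd : HasDerivAt (fun r : ℝ => P (s + r • S.φ s t).fst (t + r))
      (fderiv ℝ (fun p : E × ℝ => P p.1 p.2) (x, t) (S.fr x ur t, 1)) 0 :=
    HasFDerivAt.comp_hasDerivAt (l := fun p : E × ℝ => P p.1 p.2)
      (f := fun r : ℝ => ((s + r • S.φ s t).fst, t + r)) 0
      (by simpa using (hPs.contDiffAt.differentiableAt (by simp)).hasFDerivAt) (hx'.prodMk ht')
  have hZd : HasDerivAt (fun r : ℝ => S.ζ (s + r • S.φ s t).snd (s + r • S.φ s t).fst (t + r))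
      (S.η z t) 0 := by
    have := hasDerivAt_line (l := fun p : WithLp 2 (E × F) × ℝ => S.ζ p.1.snd p.1.fst p.2) s t (S.φ s t)
      (S.contDiff_ζ_loop.contDiffAt.differentiableAt (by simp))
    rwa [S.fderiv_ζ_loop_φ] at this
  have hQd : HasDerivAt
      (fun r : ℝ => Q (S.ζ (s + r • S.φ s t).snd (s + r • S.φ s t).fst (t + r)) (t + r))
      (fderiv ℝ (fun p : F × ℝ => Q p.1 p.2) (z, t) (S.η z t, 1)) 0 :=
    HasFDerivAt.comp_hasDerivAt (l := fun p : F × ℝ => Q p.1 p.2)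
      (f := fun r : ℝ => (S.ζ (s + r • S.φ s t).snd (s + r • S.φ s t).fst (t + r), t + r)) 0
      (by simpa using (hQs.contDiffAt.differentiableAt (by simp)).hasFDerivAt) (hZd.prodMk ht')
  have hform := ((hPd.clm_apply (hasDerivAt_const 0 v.fst)).inner ℝ
    (hasDerivAt_const 0 v.fst)).fun_add (((hQd.clm_apply hA).inner ℝ hA).const_mul κ)
  simp only [inner_metric] at hM'
  have huniq := hM'.unique hform
  simp only [zero_smul, add_zero, map_zero, inner_zero_right, zero_add,
    WithLp.zero_fst, mul_zero] at huniq
  rw [fderiv_ζs_apply] at huniq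
  simp only [← hx, ← hU, ← hz, ← ha] at huniq
  have hsq : ⟪Q z t (fderiv ℝ (fun z => S.η z t) z a), a⟫_ℝ
      = ⟪Q z t a, fderiv ℝ (fun z => S.η z t) z a⟫_ℝ := by
    rw [real_inner_comm]; exact ((hQ z t).isSymmetric a _).symm
  have hsq' : ⟪Q z t (S.ζs s t (fderiv ℝ (fun r => S.φ r t) s v)), a⟫_ℝ
      = ⟪Q z t a, S.ζs s t (fderiv ℝ (fun r => S.φ r t) s v)⟫_ℝ := by
    rw [real_inner_comm]; exact ((hQ z t).isSymmetric a _).symm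
  rw [huniq, inner_metric, inner_metric, S.fderiv_φ_fst]
  simp only [← hx, ← hU, ← hz, ← ha, ← hur, map_add, map_sub, inner_add_left, inner_add_right,
    inner_sub_left, inner_sub_right, hsq, hsq', PxU, ContinuousLinearMap.comp_apply]
  have hK : ⟪P x t (fderiv ℝ (fun μ => S.fr x μ t) ur (S.proj (S.K U x t v.fst))), v.fst⟫_ℝ
      = ⟪P x t v.fst, fderiv ℝ (fun μ => S.fr x μ t) ur (S.proj (S.K U x t v.fst))⟫_ℝ := by
    rw [real_inner_comm]; exact ((hP x t).isSymmetric v.fst _).symm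
  rw [hK]
  ring
end Loop

namespace Loop

open scoped InnerProductSpace
open Set Filter Topology

variable {E F G : Type*} [NormedAddCommGroup E] [InnerProductSpace ℝ E]
  [NormedAddCommGroup F] [InnerProductSpace ℝ F] [NormedAddCommGroup G] [InnerProductSpace ℝ G]
  {S : Loop E F G}
  {P : E → ℝ → (E →L[ℝ] E)} {Q : F → ℝ → (F →L[ℝ] F)} {βx βz βp c pmax : ℝ}

/-! ### Contraction of the closed loop and convergence -/

theorem norm_fderiv_fr_le (hfu : ∀ x u t, ‖fderiv ℝ (fun v => S.f x v t) u‖ ≤ c) (x : E) (ur : G)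
    (t : ℝ) : ‖fderiv ℝ (fun μ => S.fr x μ t) ur‖ ≤ c := by
  unfold fr
  rw [fderiv_comp_add_left (f := fun v => S.f x v t)]
  exact hfu _ _ _

/-- Strong convexity bounds the distance of `U` from the minimizer by the size of the gradient. -/
theorem norm_residual_le (U : F) (x : E) (t : ℝ) :
    ‖S.residual U x t‖ ≤ ‖S.proj‖ / S.lam * ‖S.ζ U x t‖ := by
  have h1 := mul_norm_sub_le_norm_sub (ζ := fun W => S.ζ W x t)
    (fun W => (S.hasFDerivAt_ζ_U W x t).differentiableAt) (fun W v => S.le_H W x t v) U (S.Uopt x t)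
  rw [S.ζ_Uopt, sub_zero] at h1
  have h2 : ‖U - S.Uopt x t‖ ≤ ‖S.ζ U x t‖ / S.lam := by
    rwa [le_div_iff₀ S.lam_pos, mul_comm]
  calc ‖S.residual U x t‖ = ‖S.proj (U - S.Uopt x t)‖ := by rw [residual, map_sub]
    _ ≤ ‖S.proj‖ * (‖S.ζ U x t‖ / S.lam) := (S.proj.le_opNorm _).trans (by gcongr)
    _ = ‖S.proj‖ / S.lam * ‖S.ζ U x t‖ := by ring

variable [FiniteDimensional ℝ F]

/-- If `0` is an equilibrium of the contracting virtual dynamics, then `ζ` vanishes asymptotically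
along the closed loop. -/
theorem tendsto_ζ (hβz : 0 < βz) (hQs : SmoothMetric Q) (hQpos : UniformlyPosDef Q)
    (hvirtual : ∀ z t, contractionOp Q S.η βz z t ≤ 0) (hη : ∀ t, S.η 0 t = 0) {t₀ : ℝ}
    {s : ℝ → WithLp 2 (E × F)} (hs : IsTrajectory S.φ t₀ s) :
    Tendsto (fun t => S.ζ (s t).snd (s t).fst t) atTop (𝓝 0) := by
  have hz : ∀ t ∈ Ici t₀, HasDerivWithinAt (fun t => S.ζ (s t).snd (s t).fst t)
      (S.η (S.ζ (s t).snd (s t).fst t) t) (Ici t₀) t := by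
    intro t ht
    rw [← S.fderiv_ζ_loop_φ]
    exact HasFDerivAt.comp_hasDerivWithinAt
      (l := fun p : WithLp 2 (E × F) × ℝ => S.ζ p.1.snd p.1.fst p.2)
      (f := fun t => (s t, t)) t
      (S.contDiff_ζ_loop.contDiffAt.differentiableAt (by simp)).hasFDerivAt
      ((hs t ht).prodMk (hasDerivWithinAt_id t _))
  have hzc : ContinuousOn (fun t => S.ζ (s t).snd (s t).fst t) (Ici t₀) := fun t ht =>
    (hz t ht).continuousWithinAt
  have h := tendsto_sub_of_contracting hQs hQpos S.smooth_η hβz hvirtual hz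
    (S.smooth_η.continuous.comp_continuousOn (hzc.prodMk continuousOn_id)) (y₂ := fun _ => 0)
    (fun t _ => by rw [hη]; exact hasDerivWithinAt_const t _ _)
    (fun θ _ => ⟨t₀, le_rfl, fun t _ y t' => by simpa using sq_nonneg θ⟩)
  simpa using h

variable [FiniteDimensional ℝ E]

/-- The closed loop is contracting in the metric with a large weight `κ`, except that the metric need
not be uniformly positive definite. -/
theorem exists_contractionOp_metric_le (hβp : 0 < βp) (hβx : βp < βx) (hβz : 0 < βz)
    (hfu : ∀ x u t, ‖fderiv ℝ (fun v => S.f x v t) u‖ ≤ c)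
    (hPs : SmoothMetric P) (hPpos : UniformlyPosDef P)
    (hPbdd : ∀ x t v, ⟪P x t v, v⟫_ℝ ≤ pmax * ‖v‖ ^ 2) (hpmax : 0 ≤ pmax)
    (hQs : SmoothMetric Q) (hQpos : UniformlyPosDef Q)
    (hvirtual : ∀ z t, contractionOp Q S.η βz z t ≤ 0)
    (hPK : ∀ U x t, symPart (S.PxU P x (S.residual U x t) t ∘L S.K U x t) - βp • P x t ≤ 0)
    (hfr : ∀ x ur t, contractionOp P (fun y τ => S.fr y ur τ) (βx + βp) x t ≤ 0) :
    ∃ κ : ℝ, 0 < κ ∧ ∃ γ : ℝ, 0 < γ ∧ ∀ s t, contractionOp (S.metric P Q κ) S.φ γ s t ≤ 0 := by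
  have hPsa := hPpos.isSelfAdjoint
  have hQsa := hQpos.isSelfAdjoint
  obtain ⟨μP, -, hμP⟩ := hPpos.exists_sq_le
  obtain ⟨μQ, hμQ0, hμQ⟩ := hQpos.exists_sq_le
  have hβx0 : 0 < βx := hβp.trans hβx
  have hc : 0 ≤ c := (norm_nonneg _).trans (hfu 0 0 0)
  have hlam := S.lam_pos
  -- `C ‖a‖²` bounds the form of `P` on the velocity caused by the error `a` of `ζ`
  set C := pmax * (c * ‖S.proj‖ / S.lam) ^ 2 with hC
  have hC0 : 0 ≤ C := by positivity
  -- Young's inequality with parameter `βx/2` leaves `(2/βx) C ‖a‖²`, to be absorbed by half of the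
  -- decay `κ βz ⟨Q a, a⟩ ≥ κ βz μQ² ‖a‖²`
  set κ := 1 + 4 * C / (βx * βz * μQ ^ 2) with hκ
  have hκ0 : 0 < κ := by positivity
  set γ := min βx βz / 2 with hγ
  have hγ0 : 0 < γ := by positivity
  refine ⟨κ, hκ0, γ, hγ0, fun s t => le_zero_of_inner_le_zero
    (isSelfAdjoint_contractionOp (smoothMetric_metric hPs hQs) (isSelfAdjoint_metric hPsa hQsa) _ _
      _ _) fun v => ?_⟩
  rw [inner_contractionOp_metric hPs hPsa hQs hQsa]
  set x := s.fst
  set U := s.snd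
  set ur := S.residual U x t
  set a := S.ζs s t v
  set z := S.ζ U x t
  set p := ⟪P x t v.fst, v.fst⟫_ℝ with hp
  set q := ⟪Q z t a, a⟫_ℝ with hq
  set d := fderiv ℝ (fun μ => S.fr x μ t) ur (S.proj ((S.H U x t).inverse a)) with hd
  have h1 : ⟪contractionOp P (fun y τ => S.fr y ur τ) γ x t v.fst, v.fst⟫_ℝ
      ≤ (γ - (βx + βp)) * p := by
    have h := inner_le_inner_of_le (hfr x ur t) v.fst
    rw [inner_contractionOp hPs hPsa] at h ⊢
    simp only [_root_.zero_apply, inner_zero_left] at h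
    linarith
  have h2 : ⟪symPart (S.PxU P x ur t ∘L S.K U x t) v.fst, v.fst⟫_ℝ ≤ βp * p := by
    have h := inner_le_inner_of_le (hPK U x t) v.fst
    simp only [_root_.sub_apply, _root_.smul_apply, inner_sub_left, inner_smul_left, conj_trivial,
      _root_.zero_apply, inner_zero_left] at h
    linarith
  have h3 : ⟪contractionOp Q S.η γ z t a, a⟫_ℝ ≤ (γ - βz) * q := by
    have h := inner_le_inner_of_le (hvirtual z t) a
    rw [inner_contractionOp hQs hQsa] at h ⊢
    simp only [_root_.zero_apply, inner_zero_left] at h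
    linarith
  have h4 := two_mul_inner_le (hPsa x t) (fun w => le_trans (by positivity) (hμP x t w))
    (half_pos hβx0) v.fst d
  have h5 : ⟪P x t d, d⟫_ℝ ≤ C * ‖a‖ ^ 2 := by
    have hdn : ‖d‖ ≤ c * ‖S.proj‖ / S.lam * ‖a‖ := by
      have hH := S.norm_inverse_H_apply_le U x t a
      have hH' : ‖(S.H U x t).inverse a‖ ≤ ‖a‖ / S.lam := by
        rw [le_div_iff₀ hlam, mul_comm]; exact hH
      calc ‖d‖ ≤ c * ‖S.proj ((S.H U x t).inverse a)‖ :=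
            ContinuousLinearMap.le_of_opNorm_le _ (norm_fderiv_fr_le hfu x ur t) _
        _ ≤ c * (‖S.proj‖ * (‖a‖ / S.lam)) := by
            gcongr
            exact (S.proj.le_opNorm _).trans (by gcongr)
        _ = c * ‖S.proj‖ / S.lam * ‖a‖ := by ring
    calc ⟪P x t d, d⟫_ℝ ≤ pmax * ‖d‖ ^ 2 := hPbdd x t d
      _ ≤ pmax * (c * ‖S.proj‖ / S.lam * ‖a‖) ^ 2 := by gcongr
      _ = C * ‖a‖ ^ 2 := by rw [hC]; ring
  have hp0 : 0 ≤ p := le_trans (by positivity) (hμP x t v.fst)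
  have hqa : μQ ^ 2 * ‖a‖ ^ 2 ≤ q := hμQ z t a
  have hγx : γ ≤ βx / 2 := by
    rw [hγ]; linarith [min_le_left βx βz]
  have hγz : γ ≤ βz / 2 := by
    rw [hγ]; linarith [min_le_right βx βz]
  have hq0 : 0 ≤ q := le_trans (by positivity) hqa
  have h6 : (βx / 2)⁻¹ * ⟪P x t d, d⟫_ℝ ≤ κ * (βz / 2 * q) := by
    calc (βx / 2)⁻¹ * ⟪P x t d, d⟫_ℝ ≤ (βx / 2)⁻¹ * (C * ‖a‖ ^ 2) := by gcongr
      _ = 4 * C / (βx * βz * μQ ^ 2) * (βz / 2 * (μQ ^ 2 * ‖a‖ ^ 2)) := by field_simp; ring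
      _ ≤ κ * (βz / 2 * q) := by
          gcongr
          rw [hκ]; linarith
  have h7 : κ * ⟪contractionOp Q S.η γ z t a, a⟫_ℝ ≤ κ * ((γ - βz) * q) :=
    mul_le_mul_of_nonneg_left h3 hκ0.le
  have h8 : κ * ((γ - βz) * q) ≤ κ * (-(βz / 2) * q) := by
    refine mul_le_mul_of_nonneg_left (mul_le_mul_of_nonneg_right ?_ hq0) hκ0.le
    linarith
  have h9 : (γ - βx / 2) * p ≤ 0 := mul_nonpos_of_nonpos_of_nonneg (by linarith) hp0
  linarith

/-- The metric of the closed loop is uniformly positive definite when `∂ζ/∂x` is bounded: then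
`v.snd` is controlled by `v.fst` and `∂ζ/∂s v`. -/
theorem uniformlyPosDef_metric (hPpos : UniformlyPosDef P) (hQpos : UniformlyPosDef Q) {κ : ℝ}
    (hκ : 0 < κ) (hζx : ∀ U x t, ‖S.ζx U x t‖ ≤ c) : UniformlyPosDef (S.metric P Q κ) := by
  obtain ⟨μP, hμP0, hμP⟩ := hPpos.exists_sq_le
  obtain ⟨μQ, hμQ0, hμQ⟩ := hQpos.exists_sq_le
  have hlam := S.lam_pos
  have hc : 0 ≤ c := (norm_nonneg _).trans (hζx 0 0 0)
  refine ⟨min (μP ^ 2 / (1 + 2 * c ^ 2 / S.lam ^ 2)) (κ * μQ ^ 2 * S.lam ^ 2 / 2), by positivity,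
    fun s t => smul_one_le_iff.2
      ⟨isSelfAdjoint_metric hPpos.isSelfAdjoint hQpos.isSelfAdjoint s t, fun v => ?_⟩⟩
  set ε := min (μP ^ 2 / (1 + 2 * c ^ 2 / S.lam ^ 2)) (κ * μQ ^ 2 * S.lam ^ 2 / 2) with hε
  have hε0 : 0 ≤ ε := by positivity
  have hε1 : ε * (1 + 2 * c ^ 2 / S.lam ^ 2) ≤ μP ^ 2 := by
    rw [← le_div_iff₀ (by positivity)]
    exact min_le_left _ _
  have hε2 : ε * (2 / S.lam ^ 2) ≤ κ * μQ ^ 2 := by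
    calc ε * (2 / S.lam ^ 2) ≤ κ * μQ ^ 2 * S.lam ^ 2 / 2 * (2 / S.lam ^ 2) := by
          gcongr
          exact min_le_right _ _
      _ = κ * μQ ^ 2 := by field_simp
  rw [inner_metric]
  set a := S.ζs s t v with ha
  have hsnd : ‖v.snd‖ ≤ (‖a‖ + c * ‖v.fst‖) / S.lam := by
    rw [le_div_iff₀ hlam, mul_comm]
    have h1 : S.lam * ‖v.snd‖ ≤ ‖S.H s.snd s.fst t v.snd‖ :=
      mul_norm_le_norm_of_le_inner (S.le_H s.snd s.fst t) v.snd
    have h2 : S.H s.snd s.fst t v.snd = a - S.ζx s.snd s.fst t v.fst := by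
      rw [ha, ζs_apply]; abel
    rw [h2] at h1
    exact h1.trans ((norm_sub_le _ _).trans (add_le_add le_rfl
      (ContinuousLinearMap.le_of_opNorm_le _ (hζx _ _ _) _)))
  have hsnd2 : ‖v.snd‖ ^ 2 ≤ 2 / S.lam ^ 2 * ‖a‖ ^ 2 + 2 * c ^ 2 / S.lam ^ 2 * ‖v.fst‖ ^ 2 := by
    calc ‖v.snd‖ ^ 2 ≤ ((‖a‖ + c * ‖v.fst‖) / S.lam) ^ 2 := by gcongr
      _ = (‖a‖ + c * ‖v.fst‖) ^ 2 / S.lam ^ 2 := by rw [div_pow]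
      _ ≤ (2 * ‖a‖ ^ 2 + 2 * c ^ 2 * ‖v.fst‖ ^ 2) / S.lam ^ 2 := by
          gcongr
          nlinarith [sq_nonneg (‖a‖ - c * ‖v.fst‖)]
      _ = _ := by ring
  have h1 := hμP s.fst t v.fst
  have h2 := mul_le_mul_of_nonneg_left (hμQ (S.ζ s.snd s.fst t) t a) hκ.le
  rw [WithLp.prod_norm_sq_eq_of_L2]
  calc ε * (‖v.fst‖ ^ 2 + ‖v.snd‖ ^ 2)
      ≤ ε * (‖v.fst‖ ^ 2
          + (2 / S.lam ^ 2 * ‖a‖ ^ 2 + 2 * c ^ 2 / S.lam ^ 2 * ‖v.fst‖ ^ 2)) := by gcongr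
    _ = ε * (1 + 2 * c ^ 2 / S.lam ^ 2) * ‖v.fst‖ ^ 2 + ε * (2 / S.lam ^ 2) * ‖a‖ ^ 2 := by ring
    _ ≤ μP ^ 2 * ‖v.fst‖ ^ 2 + κ * μQ ^ 2 * ‖a‖ ^ 2 := by gcongr
    _ ≤ _ := by linarith

/-- The state `x` of the closed loop is a trajectory of `f_r(·, 0, ·)` up to a disturbance bounded by
a multiple of `ζ → 0`, and the optimally controlled state is an undisturbed one. -/
theorem tendsto_fst_sub (hβ : 0 < βx + βp) (hβz : 0 < βz)
    (hfu : ∀ x u t, ‖fderiv ℝ (fun v => S.f x v t) u‖ ≤ c)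
    (hPs : SmoothMetric P) (hPpos : UniformlyPosDef P)
    (hPbdd : ∀ x t v, ⟪P x t v, v⟫_ℝ ≤ pmax * ‖v‖ ^ 2) (hpmax : 0 ≤ pmax)
    (hQs : SmoothMetric Q) (hQpos : UniformlyPosDef Q)
    (hvirtual : ∀ z t, contractionOp Q S.η βz z t ≤ 0)
    (hfr : ∀ x ur t, contractionOp P (fun y τ => S.fr y ur τ) (βx + βp) x t ≤ 0)
    (hη : ∀ t, S.η 0 t = 0) {t₀ : ℝ} {s : ℝ → WithLp 2 (E × F)} {xopt : ℝ → E}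
    (hs : IsTrajectory S.φ t₀ s)
    (hxopt : IsTrajectory (fun x t => S.f x (S.proj (S.Uopt x t)) t) t₀ xopt) :
    Tendsto (fun t => (s t).fst - xopt t) atTop (𝓝 0) := by
  have hz := tendsto_ζ hβz hQs hQpos hvirtual hη hs
  have hc : 0 ≤ c := (norm_nonneg _).trans (hfu 0 0 0)
  have hsc : ContinuousOn s (Ici t₀) := fun t ht => (hs t ht).continuousWithinAt
  have hfr0 : (fun y τ => S.fr y 0 τ) = fun x t => S.f x (S.proj (S.Uopt x t)) t := by
    funext y τ
    rw [fr, add_zero]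
  have hx : ∀ t ∈ Ici t₀, HasDerivWithinAt (fun t => (s t).fst)
      (S.f (s t).fst (S.proj (s t).snd) t) (Ici t₀) t := fun t ht =>
    (WithLp.fstL 2 ℝ E F).hasFDerivAt.comp_hasDerivWithinAt t (hs t ht)
  have hxc : ContinuousOn (fun t => S.f (s t).fst (S.proj (s t).snd) t) (Ici t₀) := by
    refine S.smooth_f.continuous.comp_continuousOn (f := fun t => ((s t).fst, S.proj (s t).snd, t))
      (((WithLp.fstL 2 ℝ E F).continuous.comp_continuousOn hsc).prodMk
        (((S.proj ∘L WithLp.sndL 2 ℝ E F).continuous.comp_continuousOn hsc).prodMk continuousOn_id))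
  refine tendsto_sub_of_contracting (g := fun y τ => S.fr y 0 τ) hPs hPpos (S.contDiff_fr 0) hβ
    (fun x t => hfr x 0 t) hx hxc (by rw [hfr0]; exact hxopt) fun θ hθ => ?_
  -- the disturbance is at most `D ‖ζ‖`
  set D := c * (‖S.proj‖ / S.lam) with hD
  have hD0 : 0 ≤ D := mul_nonneg hc (div_nonneg (norm_nonneg _) S.lam_pos.le)
  have hdist : ∀ t, ‖S.f (s t).fst (S.proj (s t).snd) t - S.fr (s t).fst 0 t‖
      ≤ D * ‖S.ζ (s t).snd (s t).fst t‖ := by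
    intro t
    have hdiff : Differentiable ℝ (fun v => S.f (s t).fst v t) :=
      (S.smooth_f.comp (f := fun v : G => ((s t).fst, v, t)) (by fun_prop)).differentiable (by simp)
    have h1 := convex_univ.norm_image_sub_le_of_norm_fderiv_le (𝕜 := ℝ)
      (f := fun v => S.f (s t).fst v t) (fun v _ => hdiff v) (fun v _ => hfu (s t).fst v t)
      (mem_univ (S.proj (S.Uopt (s t).fst t))) (mem_univ (S.proj (s t).snd))
    rw [fr, add_zero]
    refine h1.trans ?_
    rw [hD, mul_assoc]
    exact mul_le_mul_of_nonneg_left (norm_residual_le (s t).snd (s t).fst t) hc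
  have hlim : Tendsto (fun t => pmax * (D * ‖S.ζ (s t).snd (s t).fst t‖) ^ 2) atTop (𝓝 0) := by
    have h1 := ((((hz.norm).const_mul D).pow 2).const_mul pmax)
    simpa using h1
  obtain ⟨T, hT⟩ := ((hlim.eventually (gt_mem_nhds (show 0 < θ ^ 2 by positivity))).and
    (eventually_ge_atTop t₀)).exists_forall_of_atTop
  refine ⟨T, (hT T le_rfl).2, fun t ht y t' => ?_⟩
  refine (hPbdd y t' _).trans (le_trans ?_ (hT t ht).1.le)
  gcongr
  exact hdist t

end Loop

/-! ### Model predictive control as a closed loop -/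

namespace Problem

variable {n m h : ℕ}

open scoped InnerProductSpace

/-- The choice made by `Uopt` is a minimizer, since one exists, hence a zero of the gradient. -/
theorem ζ_Uopt {S : Problem n m h} {lam : ℝ} (hlam : 0 < lam)
    (hH : ∀ U x t v, lam * ‖v‖ ^ 2 ≤ ⟪S.H U x t v, v⟫_ℝ) (x : EuclideanSpace ℝ (Fin n)) (t : ℝ) :
    S.ζ (S.Uopt x t) x t = 0 := by
  have hV : Differentiable ℝ (fun W => S.V W x t) :=
    (S.contDiff_V.comp (contDiff_prodMk_left (x, t))).differentiable (by simp)
  have hζ : Differentiable ℝ (gradient fun W => S.V W x t) :=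
    (S.contDiff_ζ.comp (contDiff_prodMk_left (x, t))).differentiable (by simp)
  exact gradient_eq_zero_of_isMin
    (Classical.epsilon_spec (exists_minimizer hV hζ hlam fun W v => hH W x t v))

/-- The closed loop of a strongly convex model predictive control problem. -/
noncomputable def toLoop [NeZero h] (S : Problem n m h) (lam : ℝ) (hlam : 0 < lam)
    (hH : ∀ U x t v, lam * ‖v‖ ^ 2 ≤ ⟪S.H U x t v, v⟫_ℝ) :
    Loop (EuclideanSpace ℝ (Fin n)) (InputSeq m h) (EuclideanSpace ℝ (Fin m)) where
  f := S.f
  ζ := S.ζ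
  η := S.η
  proj := firstInput m h
  Uopt := S.Uopt
  lam := lam
  smooth_f := S.smooth_f
  smooth_ζ := S.contDiff_ζ
  smooth_η := S.smooth_η
  lam_pos := hlam
  le_H := hH
  ζ_Uopt := ζ_Uopt hlam hH

end Problem
end Continuation

theorem corollary1 {n m h : ℕ} [NeZero h] (S : Problem n m h)
    (P : EuclideanSpace ℝ (Fin n) → ℝ →
      (EuclideanSpace ℝ (Fin n) →L[ℝ] EuclideanSpace ℝ (Fin n)))
    (Q : InputSeq m h → ℝ → (InputSeq m h →L[ℝ] InputSeq m h))
    (βx βz βp : ℝ) (hβp : 0 < βp) (hβx : βp < βx) (hβz : 0 < βz)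
    -- strong convexity of the objective: `H ⪰ λ I`
    (hH : ∃ lam : ℝ, 0 < lam ∧
      ∀ U x t, lam • (1 : InputSeq m h →L[ℝ] InputSeq m h) ≤ S.H U x t)
    -- bounded `∂f/∂u`
    (hfu : ∃ c : ℝ, 0 < c ∧ ∀ x u t, ‖fderiv ℝ (fun v => S.f x v t) u‖ ≤ c)
    (hPsmooth : SmoothMetric P) (hPpos : UniformlyPosDef P)
    (hPbdd : ∃ pmax : ℝ, ∀ x t,
      P x t ≤ pmax • (1 : EuclideanSpace ℝ (Fin n) →L[ℝ] EuclideanSpace ℝ (Fin n)))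
    (hQsmooth : SmoothMetric Q) (hQpos : UniformlyPosDef Q)
    -- `L[Q, η, z, β_z] ⪯ 0`
    (hvirtual : ∀ z t, contractionOp Q S.η βz z t ≤ 0)
    -- `⟨P_{xU} K⟩ - β_p P ⪯ 0`
    (hPK : ∀ U x t,
      symPart (S.PxU P x (S.residual U x t) t ∘L S.K U x t) - βp • P x t ≤ 0)
    -- `L[P, f_r, x, β_x + β_p] ⪯ 0`
    (hfr : ∀ x ur t, contractionOp P (fun y τ => S.fr y ur τ) (βx + βp) x t ≤ 0) :
    (∃ κ : ℝ, 0 < κ ∧ ∃ γ : ℝ, 0 < γ ∧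
      ∀ s t, contractionOp (S.metric P Q κ) S.φ γ s t ≤ 0) ∧
    ((∃ c : ℝ, 0 < c ∧ ∀ U x t, ‖S.ζx U x t‖ ≤ c) → Contracting S.φ) ∧
    ((∀ t, S.η 0 t = 0) →
      ∀ (t₀ : ℝ) (s : ℝ → LoopState n m h) (xopt : ℝ → EuclideanSpace ℝ (Fin n)),
        IsTrajectory S.φ t₀ s → IsTrajectory S.fopt t₀ xopt →
          Filter.Tendsto (fun t => (s t).fst - xopt t) Filter.atTop (nhds 0)) := by
  obtain ⟨lam, hlam, hH⟩ := hH
  obtain ⟨c, -, hfu⟩ := hfu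
  obtain ⟨pmax, hPbdd⟩ := hPbdd
  have hH' : ∀ U x t v, lam * ‖v‖ ^ 2 ≤ inner ℝ (S.H U x t v) v :=
    fun U x t => (smul_one_le_iff.1 (hH U x t)).2
  -- `pmax` may be negative when `n = 0`
  have hPbdd' : ∀ x t v, inner ℝ (P x t v) v ≤ |pmax| * ‖v‖ ^ 2 := by
    intro x t v
    have h1 := inner_le_inner_of_le (hPbdd x t) v
    have h2 : inner ℝ ((pmax • (1 : EuclideanSpace ℝ (Fin n) →L[ℝ] EuclideanSpace ℝ (Fin n))) v) v
        = pmax * ‖v‖ ^ 2 := by simp [inner_smul_left]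
    rw [h2] at h1
    exact h1.trans (by gcongr; exact le_abs_self _)
  set A := S.toLoop lam hlam hH' with hA
  have h1 : ∃ κ : ℝ, 0 < κ ∧ ∃ γ : ℝ, 0 < γ ∧
      ∀ s t, contractionOp (A.metric P Q κ) A.φ γ s t ≤ 0 :=
    Loop.exists_contractionOp_metric_le hβp hβx hβz hfu hPsmooth hPpos hPbdd' (abs_nonneg _)
      hQsmooth hQpos hvirtual hPK hfr
  refine ⟨h1, ?_, ?_⟩
  · rintro ⟨c', -, hζx⟩
    obtain ⟨κ, hκ, γ, hγ, h1⟩ := h1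
    exact ⟨A.metric P Q κ, γ, Loop.smoothMetric_metric hPsmooth hQsmooth,
      Loop.uniformlyPosDef_metric hPpos hQpos hκ hζx, hγ, h1⟩
  · intro hη t₀ s xopt hs hxopt
    exact Loop.tendsto_fst_sub (S := A) (by linarith) hβz hfu hPsmooth hPpos hPbdd' (abs_nonneg _)
      hQsmooth hQpos hvirtual hfr hη hs hxopt
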